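/- Let $X$ be a compact metric space with its Borel $\sigma$-algebra and a $\sigma$-finite Borel measure $\mu$, and let $(\mathcal E,\mathcal F)$ be a Dirichlet form on the real Hilbert space $L^2(\mu)$: a non-negative, symmetric, closed bilinear form $\mathcal E$ with dense domain $\mathcal F\subset L^2(\mu)$ such that $u\in\mathcal F$ implies $\tilde u=\min\{1,\max\{u,0\}\}\in\mathcal F$ and $\mathcal E(\tilde u,\tilde u)\le\mathcal E(u,u)$. Assume that $\mathcal E$ is - conservative: $\mathcal E(u,v)=0$ whenever $u,v\in\mathcal F$ and $u$ or $v$ is ($\mu$-a.e.) constant; - strongly local: $\mathcal E(u,v)=0$ whenever $u,v\in\mathcal F$ and $u$ is constant on a neighbourhood of the support of $v$, or vice versa; - regular: $\mathcal F\cap C(X)$ contains a subspace which is dense in $C(X)$ for the supremum norm and dense in $\mathcal F$ for the norm $(\mathcal E(u,u)+\|u\|_2^2)^{1/2}$. Let $\mathcal B=\mathcal F\cap L^\infty(\mu)$, which is an algebra under pointwise multiplication and contains the constant function $\mathbf 1$. On the algebraic tensor product $\mathcal B\otimes\mathcal B$ consider the symmetric bilinear form determined by $$\langle a\otimes b,\,c\otimes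 d\rangle_{\mathcal H}=\tfrac12\bigl(\mathcal E(a,cdb)+\mathcal E(abd,c)-\mathcal E(bd,ac)\bigr)$$ and the left and right actions of $\mathcal B$ determined by $$a(b\otimes c)=(ab)\otimes c-a\otimes(bc),\qquad (b\otimes c)d=b\otimes(cd).$$ Then the form is positive semi-definite and, for the associated semi-norm, $\|a\,t\|_{\mathcal H}\le\|a\|_\infty\|t\|_{\mathcal H}$ and $\|t\,a\|_{\mathcal H}\le\|a\|_\infty\|t\|_{\mathcal H}$ for all $a\in\mathcal B$, $t\in\mathcal B\otimes\mathcal B$. Hence the quotient of $\mathcal B\otimes\mathcal B$ by the vectors of norm zero has a Hilbert space completion $\mathcal H$, to which both actions extend by continuity. In $\mathcal H$ one has $$a(b\otimes c)=(b\otimes c)a\qquad\text{for all }a,b,c\in\mathcal B,$$ consequently $a\xi=\xi a$ for all $a\in\mathcal B$ and $\xi\in\mathcal H$. In particular, the derivation $\partial a=a\otimes\mathbf 1$ satisfies $\partial(ab)=a\,\partial b+b\,\partial a$ for all $a,b\in\mathcal B$. -/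

import Mathlib

open MeasureTheory Filter Topology
open scoped ENNReal TensorProduct

/-- A (symmetric) Dirichlet form on the real Hilbert space `L²(X, μ)`: a non-negative symmetric
bilinear form on a dense subspace `domain`, closed (the domain is complete for the norm
`(form u u + ‖u‖²)^(1/2)`), and sub-Markovian (the unit contraction `min 1 (max u 0)` operates
on the domain and does not increase the energy). -/
structure DirichletForm {X : Type*} [MeasurableSpace X] (μ : Measure X) where
  domain : Submodule ℝ (Lp ℝ 2 μ)
  form : domain →ₗ[ℝ] domain →ₗ[ℝ] ℝ
  dense_domain : Dense (domain : Set (Lp ℝ 2 μ))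
  symm : ∀ u v : domain, form u v = form v u
  nonneg : ∀ u : domain, 0 ≤ form u u
  closed : ∀ u : ℕ → domain,
    (∀ ε : ℝ, 0 < ε → ∃ N : ℕ, ∀ m n : ℕ, N ≤ m → N ≤ n →
      form (u m - u n) (u m - u n) + ‖u m - u n‖ ^ 2 < ε) →
    ∃ v : domain,
      Tendsto (fun n => form (u n - v) (u n - v) + ‖u n - v‖ ^ 2) atTop (𝓝 0)
  markov : ∀ u : domain, ∃ v : domain,
    ((v : Lp ℝ 2 μ) : X → ℝ) =ᵐ[μ] (fun x => min 1 (max (((u : Lp ℝ 2 μ) : X → ℝ) x) 0)) ∧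
      form v v ≤ form u u

namespace DirichletForm

section General

variable {X : Type*} [MeasurableSpace X] {μ : Measure X} (E : DirichletForm μ)

/-- The domain vector `u` represents the function `f`. -/
def Rep (u : E.domain) (f : X → ℝ) : Prop := ((u : Lp ℝ 2 μ) : X → ℝ) =ᵐ[μ] f

/-! ### Bounded functions of the domain form an algebra -/

variable {E}

lemma Rep.add {u v : E.domain} {f g : X → ℝ} (hu : E.Rep u f) (hv : E.Rep v g) :
    E.Rep (u + v) (fun x => f x + g x) := by
  have h := Lp.coeFn_add (u : Lp ℝ 2 μ) (v : Lp ℝ 2 μ)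
  unfold Rep at *
  filter_upwards [hu, hv, h] with x h1 h2 h3
  simp only [Submodule.coe_add, h3, Pi.add_apply, h1, h2]

lemma Rep.smul {u : E.domain} {f : X → ℝ} (c : ℝ) (hu : E.Rep u f) :
    E.Rep (c • u) (fun x => c * f x) := by
  have h := Lp.coeFn_smul c (u : Lp ℝ 2 μ)
  unfold Rep at *
  filter_upwards [hu, h] with x h1 h3
  simp only [Submodule.coe_smul, h3, Pi.smul_apply, h1, smul_eq_mul]

lemma Rep.sub {u v : E.domain} {f g : X → ℝ} (hu : E.Rep u f) (hv : E.Rep v g) :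
    E.Rep (u - v) (fun x => f x - g x) := by
  have h := hu.add (hv.smul (-1))
  have e : u + (-1 : ℝ) • v = u - v := by simp [sub_eq_add_neg]
  rw [e] at h
  unfold Rep at *
  filter_upwards [h] with x h1
  rw [h1]; ring

lemma Rep.sum {ι : Type*} (s : Finset ι) {u : ι → E.domain} {f : ι → X → ℝ}
    (h : ∀ i, E.Rep (u i) (f i)) : E.Rep (∑ i ∈ s, u i) (fun x => ∑ i ∈ s, f i x) := by
  classical
  induction s using Finset.induction_on with
  | empty =>
    unfold Rep
    simp only [Finset.sum_empty, Submodule.coe_zero]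
    exact Lp.coeFn_zero ℝ 2 μ
  | insert a s ha ih =>
    simp only [Finset.sum_insert ha]
    exact (h a).add ih

variable (E)

lemma form_sub_le (u v : E.domain) :
    E.form (u - v) (u - v) ≤ 2 * E.form u u + 2 * E.form v v := by
  have h := E.nonneg (u + v)
  have hs := E.symm u v
  simp only [map_add, map_sub, LinearMap.add_apply, LinearMap.sub_apply] at h ⊢
  linarith

lemma form_le_half (u v : E.domain) : E.form u v ≤ (E.form u u + E.form v v) / 2 := by
  have h := E.nonneg (u - v)
  have hs := E.symm u v
  simp only [map_sub, LinearMap.sub_apply] at h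
  linarith

lemma form_sum_le (n : ℕ) (u : ℕ → E.domain) (C : ℝ) (h : ∀ k, E.form (u k) (u k) ≤ C) :
    E.form (∑ k ∈ Finset.range n, u k) (∑ k ∈ Finset.range n, u k) ≤ n * (n * C) := by
  rw [map_sum E.form, LinearMap.sum_apply]
  calc _ ≤ ∑ _k ∈ Finset.range n, (n * C) := by
        refine Finset.sum_le_sum fun i _ => ?_
        rw [map_sum]
        calc _ ≤ ∑ _k ∈ Finset.range n, C := by
              refine Finset.sum_le_sum fun j _ => ?_
              have h1 := E.form_le_half (u i) (u j)
              have h2 := h i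
              have h3 := h j
              linarith
          _ = n * C := by simp
    _ = n * (n * C) := by simp

/-- `L²`-limits of energy-bounded sequences lie in the domain. -/
lemma mem_domain_of_tendsto (f : Lp ℝ 2 μ) (C : ℝ)
    (h : ∀ δ : ℝ, 0 < δ → ∃ w : E.domain, ‖(w : Lp ℝ 2 μ) - f‖ ≤ δ ∧ E.form w w ≤ C) :
    f ∈ E.domain := by
  let S : ℝ → Set ℝ := fun δ => {r | ∃ w : E.domain, ‖(w : Lp ℝ 2 μ) - f‖ ≤ δ ∧ E.form w w = r}
  have hbdd : ∀ δ, BddBelow (S δ) := fun δ => ⟨0, by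
    rintro r ⟨w, -, rfl⟩; exact E.nonneg w⟩
  have hne : ∀ δ, 0 < δ → (S δ).Nonempty := fun δ hδ => by
    obtain ⟨w, hw, -⟩ := h δ hδ
    exact ⟨_, w, hw, rfl⟩
  have hmC : ∀ δ, 0 < δ → sInf (S δ) ≤ C := fun δ hδ => by
    obtain ⟨w, hw, hC⟩ := h δ hδ
    exact (csInf_le (hbdd δ) ⟨w, hw, rfl⟩).trans hC
  have hanti : ∀ δ δ', 0 < δ' → δ' ≤ δ → sInf (S δ) ≤ sInf (S δ') := fun δ δ' hδ' hle =>
    csInf_le_csInf (hbdd δ) (hne δ' hδ') (by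
      rintro r ⟨w, hw, rfl⟩; exact ⟨w, hw.trans hle, rfl⟩)
  let d : ℕ → ℝ := fun n => 1 / ((n : ℝ) + 1)
  have hd : ∀ n, 0 < d n := fun n => by positivity
  have hdanti : ∀ m n, m ≤ n → d n ≤ d m := fun m n hmn => by
    simp only [d]; gcongr
  have hdlim : Tendsto d atTop (𝓝 0) := tendsto_one_div_add_atTop_nhds_zero_nat
  let m : ℕ → ℝ := fun n => sInf (S (d n))
  have hmono : Monotone m := fun i j hij => hanti _ _ (hd j) (hdanti i j hij)
  have hbd : BddAbove (Set.range m) := ⟨C, by rintro _ ⟨n, rfl⟩; exact hmC _ (hd n)⟩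
  have hlim := tendsto_atTop_ciSup hmono hbd
  set M := ⨆ n, m n with hM
  have hmM : ∀ n, m n ≤ M := fun n => le_ciSup hbd n
  have hex : ∀ n, ∃ w : E.domain, ‖(w : Lp ℝ 2 μ) - f‖ ≤ d n ∧ E.form w w < M + d n := by
    intro n
    obtain ⟨r, ⟨w, hw, rfl⟩, hr⟩ := exists_lt_of_csInf_lt (hne _ (hd n))
      (show sInf (S (d n)) < M + d n from (hmM n).trans_lt (by linarith [hd n]))
    exact ⟨w, hw, hr⟩
  choose w hw1 hw2 using hex
  have key : ∀ N i j, N ≤ i → N ≤ j →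
      E.form (w i - w j) (w i - w j) ≤ 4 * (M - m N) + 4 * d N ∧ ‖w i - w j‖ ≤ 2 * d N := by
    intro N i j hi hj
    have hi1 := (hw1 i).trans (hdanti _ _ hi)
    have hj1 := (hw1 j).trans (hdanti _ _ hj)
    have hi2 := (hw2 i).trans_le (add_le_add_right (hdanti _ _ hi) M)
    have hj2 := (hw2 j).trans_le (add_le_add_right (hdanti _ _ hj) M)
    constructor
    · have hmid : m N ≤ E.form ((1 / 2 : ℝ) • (w i + w j)) ((1 / 2 : ℝ) • (w i + w j)) := by
        refine csInf_le (hbdd _) ⟨_, ?_, rfl⟩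
        have e : (((1 / 2 : ℝ) • (w i + w j) : E.domain) : Lp ℝ 2 μ) - f
            = (1 / 2 : ℝ) • (((w i : Lp ℝ 2 μ) - f) + ((w j : Lp ℝ 2 μ) - f)) := by
          simp only [Submodule.coe_smul, Submodule.coe_add]
          module
        rw [e, norm_smul]
        have := norm_add_le ((w i : Lp ℝ 2 μ) - f) ((w j : Lp ℝ 2 μ) - f)
        norm_num
        linarith
      have hs := E.symm (w i) (w j)
      simp only [map_add, map_sub, map_smul, LinearMap.add_apply, LinearMap.sub_apply,
        LinearMap.smul_apply, smul_eq_mul] at hmid ⊢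
      linarith
    · have e : ‖w i - w j‖ = ‖((w i : Lp ℝ 2 μ) - f) - ((w j : Lp ℝ 2 μ) - f)‖ := by
        rw [sub_sub_sub_cancel_right]; rfl
      rw [e]
      have := norm_sub_le ((w i : Lp ℝ 2 μ) - f) ((w j : Lp ℝ 2 μ) - f)
      linarith
  have hB : Tendsto (fun N => (4 * (M - m N) + 4 * d N) + (2 * d N) ^ 2) atTop (𝓝 0) := by
    have h1 : Tendsto (fun N => (4 * (M - m N) + 4 * d N) + (2 * d N) ^ 2) atTop
        (𝓝 ((4 * (M - M) + 4 * 0) + (2 * 0) ^ 2)) :=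
      (((hlim.const_sub M).const_mul 4).add (hdlim.const_mul 4)).add ((hdlim.const_mul 2).pow 2)
    simpa using h1
  obtain ⟨v, hv⟩ := E.closed w (by
    intro ε hε
    obtain ⟨N, hN⟩ := (hB.eventually (gt_mem_nhds hε)).exists
    refine ⟨N, fun i j hi hj => ?_⟩
    obtain ⟨k1, k2⟩ := key N i j hi hj
    have : ‖w i - w j‖ ^ 2 ≤ (2 * d N) ^ 2 := by gcongr
    linarith)
  have hsq : Tendsto (fun n => ‖w n - v‖ ^ 2) atTop (𝓝 0) :=
    squeeze_zero (fun n => by positivity) (fun n => by linarith [E.nonneg (w n - v)]) hv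
  have hnorm : Tendsto (fun n => ‖w n - v‖) atTop (𝓝 0) := by
    have := (Real.continuous_sqrt.tendsto 0).comp hsq
    simpa [Function.comp_def, Real.sqrt_sq (norm_nonneg _)] using this
  have h1 : Tendsto (fun n => ((w n : E.domain) : Lp ℝ 2 μ)) atTop (𝓝 (v : Lp ℝ 2 μ)) := by
    rw [tendsto_iff_norm_sub_tendsto_zero]; exact hnorm
  have h2 : Tendsto (fun n => ((w n : E.domain) : Lp ℝ 2 μ)) atTop (𝓝 f) := by
    rw [tendsto_iff_norm_sub_tendsto_zero]
    exact squeeze_zero (fun n => norm_nonneg _) hw1 hdlim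
  rw [tendsto_nhds_unique h2 h1]
  exact v.2

lemma exists_trunc (u : E.domain) {s : ℝ} (hs : 0 < s) : ∃ w : E.domain,
    E.Rep w (fun x => min s (max (((u : Lp ℝ 2 μ) : X → ℝ) x) 0)) ∧
      E.form w w ≤ E.form u u := by
  obtain ⟨v, hv, hle⟩ := E.markov (s⁻¹ • u)
  refine ⟨s • v, ?_, ?_⟩
  · have h0 : E.Rep u ((u : Lp ℝ 2 μ) : X → ℝ) := EventuallyEq.rfl
    have h1 := h0.smul s⁻¹
    have h2 := Rep.smul s (show E.Rep v _ from hv)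
    unfold Rep at *
    filter_upwards [h1, h2] with x h1 h2
    rw [h2, h1]
    rw [mul_min_of_nonneg _ _ hs.le, mul_max_of_nonneg _ _ hs.le, mul_one, mul_zero,
      mul_inv_cancel_left₀ hs.ne']
  · simp only [map_smul, LinearMap.smul_apply, smul_eq_mul] at hle ⊢
    calc s * (s * E.form v v) ≤ s * (s * (s⁻¹ * (s⁻¹ * E.form u u))) := by gcongr
      _ = E.form u u := by field_simp

/-- The Riemann sum estimate behind `t² = 2 ∫₀^∞ (t - s)⁺ ds`. -/
lemma riemann_sq_aux {t h : ℝ} (ht : 0 ≤ t) (hh : 0 ≤ h) (m : ℕ) :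
    0 ≤ t ^ 2 - (max (t - m * h) 0) ^ 2
        - 2 * h * ∑ k ∈ Finset.range m, max (t - ((k : ℝ) + 1) * h) 0 ∧
      t ^ 2 - (max (t - m * h) 0) ^ 2
        - 2 * h * ∑ k ∈ Finset.range m, max (t - ((k : ℝ) + 1) * h) 0
        ≤ h * (t - max (t - m * h) 0) := by
  induction m with
  | zero => simp [ht]
  | succ m ih =>
    rw [Finset.sum_range_succ]
    push_cast
    have hstep : 0 ≤ (max (t - m * h) 0) ^ 2 - (max (t - ((m : ℝ) + 1) * h) 0) ^ 2
          - 2 * h * max (t - ((m : ℝ) + 1) * h) 0 ∧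
        (max (t - m * h) 0) ^ 2 - (max (t - ((m : ℝ) + 1) * h) 0) ^ 2
          - 2 * h * max (t - ((m : ℝ) + 1) * h) 0
          ≤ h * (max (t - m * h) 0 - max (t - ((m : ℝ) + 1) * h) 0) := by
      have e : t - ((m : ℝ) + 1) * h = (t - m * h) - h := by ring
      rw [e]
      generalize t - m * h = r
      rcases le_total r 0 with h1 | h1
      · rw [max_eq_right h1, max_eq_right (by linarith)]; simp
      · rcases le_total (r - h) 0 with h2 | h2
        · rw [max_eq_left h1, max_eq_right h2]
          constructor <;> nlinarith
        · rw [max_eq_left h1, max_eq_left h2]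
          constructor <;> nlinarith
    constructor <;> linarith [ih.1, ih.2, hstep.1, hstep.2]

lemma exists_sq_of_nonneg (u : E.domain) {M : ℝ} (hM : 0 < M)
    (h0 : ∀ᵐ x ∂μ, 0 ≤ ((u : Lp ℝ 2 μ) : X → ℝ) x)
    (h1 : ∀ᵐ x ∂μ, ((u : Lp ℝ 2 μ) : X → ℝ) x ≤ M) :
    ∃ w : E.domain, E.Rep w (fun x => (((u : Lp ℝ 2 μ) : X → ℝ) x) ^ 2) := by
  set f : X → ℝ := ((u : Lp ℝ 2 μ) : X → ℝ) with hf
  have hfm : MemLp f 2 μ := Lp.memLp _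
  have hsq : MemLp (fun x => (f x) ^ 2) 2 μ := by
    refine MemLp.of_le_mul (c := M) hfm (hfm.1.pow 2) ?_
    filter_upwards [h0, h1] with x a b
    rw [Real.norm_of_nonneg (by positivity), Real.norm_of_nonneg a]
    nlinarith
  have hmem : hsq.toLp _ ∈ E.domain := by
    refine E.mem_domain_of_tendsto _ (16 * M ^ 2 * E.form u u) fun δ hδ => ?_
    obtain ⟨n, hn⟩ := exists_nat_gt (M * ‖(u : Lp ℝ 2 μ)‖ / δ)
    have hnpos : (0 : ℝ) < (n : ℝ) + 1 := by positivity
    set N : ℕ := n + 1 with hN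
    have hNr : (N : ℝ) = n + 1 := by simp [hN]
    set h : ℝ := M / N with hh
    have hhpos : 0 < h := by rw [hh, hNr]; positivity
    have hNh : (N : ℝ) * h = M := by rw [hh, hNr]; field_simp
    have htr : ∀ k : ℕ, ∃ w : E.domain, E.Rep w (fun x => max (f x - ((k : ℝ) + 1) * h) 0) ∧
        E.form w w ≤ 4 * E.form u u := by
      intro k
      have hs : 0 < ((k : ℝ) + 1) * h := by positivity
      obtain ⟨w, hw, hwle⟩ := E.exists_trunc u hs
      refine ⟨u - w, ?_, ?_⟩
      · have hu : E.Rep u f := EventuallyEq.rfl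
        have := hu.sub hw
        unfold Rep at *
        filter_upwards [this, h0] with x hx hx0
        rw [hx, ← hf, max_eq_left hx0]
        rcases le_total (((k : ℝ) + 1) * h) (f x) with hc | hc
        · rw [min_eq_left hc, max_eq_left (by linarith)]
        · rw [min_eq_right hc, max_eq_right (by linarith), sub_self]
      · have := E.form_sub_le u w
        linarith
    choose w hw hwle using htr
    refine ⟨(2 * h) • ∑ k ∈ Finset.range N, w k, ?_, ?_⟩
    · have hrep := (Rep.sum (Finset.range N) hw).smul (2 * h)
      have hb : ‖(((2 * h) • ∑ k ∈ Finset.range N, w k : E.domain) : Lp ℝ 2 μ) - hsq.toLp _‖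
          ≤ h * ‖(u : Lp ℝ 2 μ)‖ := by
        refine Lp.norm_le_mul_norm_of_ae_le_mul ?_
        unfold Rep at hrep
        filter_upwards [hrep, h0, h1, hsq.coeFn_toLp, Lp.coeFn_sub
          (((2 * h) • ∑ k ∈ Finset.range N, w k : E.domain) : Lp ℝ 2 μ) (hsq.toLp _)]
          with x a b c d e
        rw [e, Pi.sub_apply, a, d, ← hf, Real.norm_of_nonneg b, Real.norm_eq_abs, abs_le]
        obtain ⟨r1, r2⟩ := riemann_sq_aux b hhpos.le N
        have hz : max (f x - N * h) 0 = 0 := by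
          rw [hNh]; exact max_eq_right (by linarith)
        rw [hz] at r1 r2
        have hp : 0 ≤ h * f x := by positivity
        constructor <;> linarith
      refine hb.trans ?_
      rw [hh, hNr, div_mul_eq_mul_div, div_le_iff₀ hnpos]
      rw [div_lt_iff₀ hδ] at hn
      nlinarith
    · have hs := E.form_sum_le N w (4 * E.form u u) hwle
      simp only [map_smul, LinearMap.smul_apply, smul_eq_mul]
      calc _ = (4 * h ^ 2) * E.form (∑ k ∈ Finset.range N, w k) (∑ k ∈ Finset.range N, w k) := by
            ring
        _ ≤ (4 * h ^ 2) * (N * (N * (4 * E.form u u))) := by gcongr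
        _ = 16 * ((N : ℝ) * h) ^ 2 * E.form u u := by ring
        _ = _ := by rw [hNh]
  exact ⟨⟨_, hmem⟩, hsq.coeFn_toLp⟩

lemma ae_bound {f : X → ℝ} (h : eLpNorm f ∞ μ < ∞) :
    ∃ M : ℝ, 0 < M ∧ ∀ᵐ x ∂μ, |f x| ≤ M := by
  rw [eLpNorm_exponent_top] at h
  refine ⟨(eLpNormEssSup f μ).toReal + 1, by positivity, ?_⟩
  filter_upwards [enorm_ae_le_eLpNormEssSup f μ] with x hx
  have := (ENNReal.toReal_le_toReal (by simp) h.ne).2 hx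
  simp only [toReal_enorm, Real.norm_eq_abs] at this
  linarith

lemma exists_sq (u : E.domain) (hb : eLpNorm ((u : Lp ℝ 2 μ) : X → ℝ) ∞ μ < ∞) :
    ∃ w : E.domain, E.Rep w (fun x => (((u : Lp ℝ 2 μ) : X → ℝ) x) ^ 2) := by
  obtain ⟨M, hM, hle⟩ := ae_bound hb
  obtain ⟨p, hp, -⟩ := E.exists_trunc u hM
  obtain ⟨q, hq, -⟩ := E.exists_trunc (-u) hM
  have hneg : E.Rep (-u) (fun x => -((u : Lp ℝ 2 μ) : X → ℝ) x) := by
    have := Rep.smul (-1) (show E.Rep u ((u : Lp ℝ 2 μ) : X → ℝ) from EventuallyEq.rfl)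
    simpa using this
  unfold Rep at hp hq hneg
  obtain ⟨p2, hp2⟩ := E.exists_sq_of_nonneg p hM
    (by filter_upwards [hp] with x hx; rw [hx]; exact le_min hM.le (le_max_right _ _))
    (by filter_upwards [hp] with x hx; rw [hx]; exact min_le_left _ _)
  obtain ⟨q2, hq2⟩ := E.exists_sq_of_nonneg q hM
    (by filter_upwards [hq] with x hx; rw [hx]; exact le_min hM.le (le_max_right _ _))
    (by filter_upwards [hq] with x hx; rw [hx]; exact min_le_left _ _)
  refine ⟨p2 + q2, ?_⟩
  have := hp2.add hq2
  unfold Rep at *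
  filter_upwards [this, hp, hq, hneg, hle] with x a b c d e
  rw [a, b, c, d]
  generalize ((u : Lp ℝ 2 μ) : X → ℝ) x = t at *
  rw [abs_le] at e
  rcases le_total 0 t with ht | ht
  · rw [max_eq_left ht, max_eq_right (by linarith), min_eq_right e.2, min_eq_right hM.le]; ring
  · rw [max_eq_right ht, max_eq_left (by linarith), min_eq_right hM.le,
      min_eq_right (by linarith)]; ring

/-- `𝓑 = 𝓕 ∩ L^∞(μ)`, the essentially bounded elements of the domain. -/
def bdd : Submodule ℝ (Lp ℝ 2 μ) where
  carrier := {u | u ∈ E.domain ∧ eLpNorm (u : X → ℝ) ∞ μ < ∞}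
  zero_mem' := ⟨E.domain.zero_mem, by
    rw [eLpNorm_congr_ae (Lp.coeFn_zero ℝ 2 μ)]; simp⟩
  add_mem' := by
    rintro u v ⟨hu, hu'⟩ ⟨hv, hv'⟩
    refine ⟨E.domain.add_mem hu hv, ?_⟩
    rw [eLpNorm_congr_ae (Lp.coeFn_add u v)]
    exact eLpNorm_add_lt_top ⟨(Lp.aestronglyMeasurable u), hu'⟩
      ⟨(Lp.aestronglyMeasurable v), hv'⟩
  smul_mem' := by
    rintro c u ⟨hu, hu'⟩
    refine ⟨E.domain.smul_mem c hu, ?_⟩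
    rw [eLpNorm_congr_ae (Lp.coeFn_smul c u)]
    exact (MemLp.const_smul ⟨(Lp.aestronglyMeasurable u), hu'⟩ c).2

/-- `a` as an almost-everywhere defined function. -/
noncomputable abbrev fn {E : DirichletForm μ} (a : E.bdd) : X → ℝ := ((a : Lp ℝ 2 μ) : X → ℝ)

/-- The norm of `a` in `L^∞(μ)`. -/
noncomputable def supNorm {E : DirichletForm μ} (a : E.bdd) : ℝ := (eLpNorm (fn a) ∞ μ).toReal

/-- The inclusion of `𝓑` into the domain. -/
def incl : E.bdd →ₗ[ℝ] E.domain := Submodule.inclusion fun _ h => h.1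

lemma exists_mul (a b : E.bdd) : ∃ c : E.bdd, fn c =ᵐ[μ] fun x => fn a x * fn b x := by
  obtain ⟨p, hp⟩ := E.exists_sq (E.incl (a + b)) (a + b).2.2
  obtain ⟨q, hq⟩ := E.exists_sq (E.incl (a - b)) (a - b).2.2
  have h := (hp.sub hq).smul (1 / 4)
  have key : (((1 / 4 : ℝ) • (p - q) : E.domain) : Lp ℝ 2 μ) =ᵐ[μ]
      fun x => fn a x * fn b x := by
    unfold Rep at h
    filter_upwards [h, Lp.coeFn_add (a : Lp ℝ 2 μ) (b : Lp ℝ 2 μ),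
      Lp.coeFn_sub (a : Lp ℝ 2 μ) (b : Lp ℝ 2 μ)] with x h1 h2 h3
    rw [h1]
    simp only [Pi.add_apply, Pi.sub_apply] at h2 h3
    have e1 : ((E.incl (a + b) : Lp ℝ 2 μ) : X → ℝ) x = fn a x + fn b x := h2
    have e2 : ((E.incl (a - b) : Lp ℝ 2 μ) : X → ℝ) x = fn a x - fn b x := h3
    rw [e1, e2]; ring
  refine ⟨⟨_, ((1 / 4 : ℝ) • (p - q) : E.domain).2, ?_⟩, key⟩
  rw [eLpNorm_congr_ae key]
  exact (MemLp.mul' (p := ∞) (q := ∞) (r := ∞)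
    (⟨Lp.aestronglyMeasurable _, b.2.2⟩ : MemLp (fn b) ∞ μ)
    (⟨Lp.aestronglyMeasurable _, a.2.2⟩ : MemLp (fn a) ∞ μ)).2

/-- Multiplication on `𝓑` is the pointwise multiplication. -/
noncomputable instance : Mul E.bdd := ⟨fun a b => (E.exists_mul a b).choose⟩

variable {E}

lemma fn_mul (a b : E.bdd) : fn (a * b) =ᵐ[μ] fun x => fn a x * fn b x :=
  (E.exists_mul a b).choose_spec

lemma fn_add (a b : E.bdd) : fn (a + b) =ᵐ[μ] fun x => fn a x + fn b x :=
  Lp.coeFn_add (a : Lp ℝ 2 μ) (b : Lp ℝ 2 μ)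

lemma fn_smul (r : ℝ) (a : E.bdd) : fn (r • a) =ᵐ[μ] fun x => r * fn a x :=
  Lp.coeFn_smul r (a : Lp ℝ 2 μ)

lemma fn_zero : fn (0 : E.bdd) =ᵐ[μ] fun _ => 0 := Lp.coeFn_zero ℝ 2 μ

lemma bdd_ext {a b : E.bdd} (h : fn a =ᵐ[μ] fn b) : a = b := Subtype.ext (Lp.ext h)

variable (E)

noncomputable instance : NonUnitalCommRing E.bdd where
  left_distrib a b c := bdd_ext (by
    filter_upwards [fn_mul a (b + c), fn_add b c, fn_add (a * b) (a * c), fn_mul a b, fn_mul a c]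
      with x h1 h2 h3 h4 h5
    rw [h1, h2, h3, h4, h5]; ring)
  right_distrib a b c := bdd_ext (by
    filter_upwards [fn_mul (a + b) c, fn_add a b, fn_add (a * c) (b * c), fn_mul a c, fn_mul b c]
      with x h1 h2 h3 h4 h5
    rw [h1, h2, h3, h4, h5]; ring)
  zero_mul a := bdd_ext (by
    filter_upwards [fn_mul 0 a, fn_zero (E := E)] with x h1 h2
    rw [h1, h2]; ring)
  mul_zero a := bdd_ext (by
    filter_upwards [fn_mul a 0, fn_zero (E := E)] with x h1 h2
    rw [h1, h2]; ring)
  mul_assoc a b c := bdd_ext (by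
    filter_upwards [fn_mul (a * b) c, fn_mul a b, fn_mul a (b * c), fn_mul b c] with x h1 h2 h3 h4
    rw [h1, h2, h3, h4]; ring)
  mul_comm a b := bdd_ext (by
    filter_upwards [fn_mul a b, fn_mul b a] with x h1 h2
    rw [h1, h2]; ring)

instance : IsScalarTower ℝ E.bdd E.bdd := ⟨fun r a b => bdd_ext (by
  simp only [smul_eq_mul]
  filter_upwards [fn_mul (r • a) b, fn_smul r a, fn_smul r (a * b), fn_mul a b]
    with x h1 h2 h3 h4
  rw [h1, h2, h3, h4]; ring)⟩

instance : SMulCommClass ℝ E.bdd E.bdd := ⟨fun r a b => by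
  simp only [smul_eq_mul]
  rw [mul_comm a (r • b), smul_mul_assoc, mul_comm b a]⟩

/-! ### The pre-Hilbert space `𝓑 ⊗ 𝓑` with its two actions of `𝓑` -/

/-- The energy form on `𝓑`. -/
noncomputable def energy : E.bdd →ₗ[ℝ] E.bdd →ₗ[ℝ] ℝ := E.form.compl₁₂ E.incl E.incl

/-- For fixed `a, b`, the functional
`c ⊗ d ↦ (𝓔(a, c d b) + 𝓔(a b d, c) - 𝓔(b d, a c)) / 2`. -/
noncomputable def tensorFormAux (a b : E.bdd) : E.bdd ⊗[ℝ] E.bdd →ₗ[ℝ] ℝ :=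
  TensorProduct.lift <| LinearMap.mk₂ ℝ
    (fun c d => (1 / 2 : ℝ) *
      (E.energy a (c * d * b) + E.energy (a * b * d) c - E.energy (b * d) (a * c)))
    (by intros; simp only [add_mul, mul_add, map_add]; ring)
    (by intros; simp only [smul_mul_assoc, mul_smul_comm, map_smul, smul_eq_mul]; ring)
    (by intros; simp only [add_mul, mul_add, map_add, LinearMap.add_apply]; ring)
    (by intros; simp only [smul_mul_assoc, mul_smul_comm, map_smul, LinearMap.smul_apply,
          smul_eq_mul]; ring)

/-- The bilinear form on `𝓑 ⊗ 𝓑` with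
`⟨a ⊗ b, c ⊗ d⟩ = (𝓔(a, c d b) + 𝓔(a b d, c) - 𝓔(b d, a c)) / 2`. -/
noncomputable def tensorForm : E.bdd ⊗[ℝ] E.bdd →ₗ[ℝ] E.bdd ⊗[ℝ] E.bdd →ₗ[ℝ] ℝ :=
  TensorProduct.lift <| LinearMap.mk₂ ℝ E.tensorFormAux
    (by
      intros; ext
      simp only [tensorFormAux, add_mul, map_add, LinearMap.add_apply,
        TensorProduct.AlgebraTensorModule.curry_apply, LinearMap.restrictScalars_self,
        TensorProduct.curry_apply, TensorProduct.lift.tmul, LinearMap.mk₂_apply]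
      ring)
    (by
      intros; ext
      simp only [tensorFormAux, smul_mul_assoc, map_smul, LinearMap.smul_apply,
        TensorProduct.AlgebraTensorModule.curry_apply, LinearMap.restrictScalars_self,
        TensorProduct.curry_apply, TensorProduct.lift.tmul, LinearMap.mk₂_apply, smul_eq_mul]
      ring)
    (by
      intros; ext
      simp only [tensorFormAux, add_mul, mul_add, map_add, LinearMap.add_apply,
        TensorProduct.AlgebraTensorModule.curry_apply, LinearMap.restrictScalars_self,
        TensorProduct.curry_apply, TensorProduct.lift.tmul, LinearMap.mk₂_apply]
      ring)
    (by
      intros; ext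
      simp only [tensorFormAux, smul_mul_assoc, mul_smul_comm, map_smul, LinearMap.smul_apply,
        TensorProduct.AlgebraTensorModule.curry_apply, LinearMap.restrictScalars_self,
        TensorProduct.curry_apply, TensorProduct.lift.tmul, LinearMap.mk₂_apply, smul_eq_mul]
      ring)

lemma tensorForm_tmul (a b c d : E.bdd) :
    E.tensorForm (a ⊗ₜ[ℝ] b) (c ⊗ₜ[ℝ] d) = (1 / 2 : ℝ) *
      (E.energy a (c * d * b) + E.energy (a * b * d) c - E.energy (b * d) (a * c)) := rfl

lemma energy_symm (a b : E.bdd) : E.energy a b = E.energy b a := E.symm _ _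

lemma tensorForm_symm (s t : E.bdd ⊗[ℝ] E.bdd) : E.tensorForm s t = E.tensorForm t s := by
  have h : E.tensorForm = E.tensorForm.flip := by
    ext a b c d
    simp only [TensorProduct.AlgebraTensorModule.curry_apply, LinearMap.restrictScalars_self,
      TensorProduct.curry_apply, LinearMap.flip_apply, tensorForm_tmul]
    have e1 : a * b * d = a * d * b := mul_right_comm a b d
    have e2 : c * d * b = c * b * d := mul_right_comm c d b
    rw [e1, e2, E.energy_symm a (c * b * d), E.energy_symm (a * d * b) c,
      mul_comm a c, mul_comm b d]
    ring
  exact congrArg (fun f => f s t) h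

/-- The left action on `𝓑 ⊗ 𝓑`: `a (b ⊗ c) = (a b) ⊗ c - a ⊗ (b c)`. -/
noncomputable def leftMul (a : E.bdd) : E.bdd ⊗[ℝ] E.bdd →ₗ[ℝ] E.bdd ⊗[ℝ] E.bdd :=
  TensorProduct.lift <| LinearMap.mk₂ ℝ (fun b c => (a * b) ⊗ₜ[ℝ] c - a ⊗ₜ[ℝ] (b * c))
    (by intros; simp only [add_mul, mul_add, TensorProduct.add_tmul, TensorProduct.tmul_add]; abel)
    (by intros; simp only [smul_mul_assoc, mul_smul_comm, TensorProduct.smul_tmul',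
          TensorProduct.tmul_smul, smul_sub])
    (by intros; simp only [mul_add, TensorProduct.tmul_add]; abel)
    (by intros; simp only [mul_smul_comm, TensorProduct.tmul_smul, smul_sub])

lemma leftMul_tmul (a b c : E.bdd) :
    E.leftMul a (b ⊗ₜ[ℝ] c) = (a * b) ⊗ₜ[ℝ] c - a ⊗ₜ[ℝ] (b * c) := rfl

/-- The right action on `𝓑 ⊗ 𝓑`: `(b ⊗ c) d = b ⊗ (c d)`. -/
noncomputable def rightMul (d : E.bdd) : E.bdd ⊗[ℝ] E.bdd →ₗ[ℝ] E.bdd ⊗[ℝ] E.bdd :=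
  TensorProduct.lift <| LinearMap.mk₂ ℝ (fun b c => b ⊗ₜ[ℝ] (c * d))
    (by intros; simp only [TensorProduct.add_tmul])
    (by intros; simp only [TensorProduct.smul_tmul'])
    (by intros; simp only [add_mul, TensorProduct.tmul_add])
    (by intros; simp only [smul_mul_assoc, TensorProduct.tmul_smul])

lemma rightMul_tmul (b c d : E.bdd) :
    E.rightMul d (b ⊗ₜ[ℝ] c) = b ⊗ₜ[ℝ] (c * d) := rfl

/-- Positive semi-definiteness of the form on `𝓑 ⊗ 𝓑`. -/
def TensorPos : Prop := ∀ t : E.bdd ⊗[ℝ] E.bdd, 0 ≤ E.tensorForm t t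

/-- `‖a t‖ ≤ ‖a‖_∞ ‖t‖` for the left action on `𝓑 ⊗ 𝓑`, in squared form. -/
def LeftBounded : Prop := ∀ (a : E.bdd) (t : E.bdd ⊗[ℝ] E.bdd),
  E.tensorForm (E.leftMul a t) (E.leftMul a t) ≤ supNorm a ^ 2 * E.tensorForm t t

/-- `‖t a‖ ≤ ‖a‖_∞ ‖t‖` for the right action on `𝓑 ⊗ 𝓑`, in squared form. -/
def RightBounded : Prop := ∀ (a : E.bdd) (t : E.bdd ⊗[ℝ] E.bdd),
  E.tensorForm (E.rightMul a t) (E.rightMul a t) ≤ supNorm a ^ 2 * E.tensorForm t t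

variable {E}

/-- The semi-inner product on `𝓑 ⊗ 𝓑`. -/
@[reducible] noncomputable def preCore (h : E.TensorPos) :
    PreInnerProductSpace.Core ℝ (E.bdd ⊗[ℝ] E.bdd) where
  inner s t := E.tensorForm s t
  conj_inner_symm s t := E.tensorForm_symm t s
  re_inner_nonneg t := h t
  add_left s t r := by rw [map_add]; rfl
  smul_left s t r := by rw [map_smul]; rfl

/-- `𝓑 ⊗ 𝓑` with the semi-inner product `tensorForm` and its semi-norm. -/
def PreHilbert (_ : E.TensorPos) : Type _ := E.bdd ⊗[ℝ] E.bdd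

noncomputable instance (h : E.TensorPos) : SeminormedAddCommGroup (PreHilbert h) :=
  @InnerProductSpace.Core.toSeminormedAddCommGroup ℝ (E.bdd ⊗[ℝ] E.bdd) _ _ _ (preCore h)

noncomputable instance (h : E.TensorPos) : InnerProductSpace ℝ (PreHilbert h) :=
  @InnerProductSpace.ofCore ℝ (E.bdd ⊗[ℝ] E.bdd) _ _ _ (preCore h)

/-- The identity map from `𝓑 ⊗ 𝓑` to `PreHilbert`. -/
noncomputable def toPre (h : E.TensorPos) : (E.bdd ⊗[ℝ] E.bdd) ≃ₗ[ℝ] PreHilbert h where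
  toFun t := t
  invFun t := t
  map_add' _ _ := rfl
  map_smul' _ _ := rfl
  left_inv _ := rfl
  right_inv _ := rfl

lemma norm_toPre (h : E.TensorPos) (t : E.bdd ⊗[ℝ] E.bdd) :
    ‖toPre h t‖ = √(E.tensorForm t t) := rfl

lemma inner_toPre (h : E.TensorPos) (s t : E.bdd ⊗[ℝ] E.bdd) :
    inner ℝ (toPre h s) (toPre h t) = E.tensorForm s t := rfl

/-- The Hilbert space `𝓗`: the Hausdorff completion of `𝓑 ⊗ 𝓑`, that is, the completion of its
quotient by the vectors of norm zero. -/
abbrev Hilb (h : E.TensorPos) : Type _ := UniformSpace.Completion (PreHilbert h)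

/-- The class in `𝓗` of an element of `𝓑 ⊗ 𝓑`. -/
noncomputable def toHilb (h : E.TensorPos) : (E.bdd ⊗[ℝ] E.bdd) →ₗ[ℝ] Hilb h :=
  (UniformSpace.Completion.toComplL (𝕜 := ℝ) (E := PreHilbert h)).toLinearMap ∘ₗ
    (toPre h).toLinearMap

lemma inner_toHilb (h : E.TensorPos) (s t : E.bdd ⊗[ℝ] E.bdd) :
    inner ℝ (toHilb h s) (toHilb h t) = E.tensorForm s t :=
  UniformSpace.Completion.inner_coe (toPre h s) (toPre h t)

lemma pre_bound (h : E.TensorPos) (f : E.bdd ⊗[ℝ] E.bdd →ₗ[ℝ] E.bdd ⊗[ℝ] E.bdd) {C : ℝ}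
    (hC : 0 ≤ C) (hf : ∀ t, E.tensorForm (f t) (f t) ≤ C ^ 2 * E.tensorForm t t)
    (t : PreHilbert h) : ‖(toPre h).conj f t‖ ≤ C * ‖t‖ := by
  obtain ⟨t, rfl⟩ := (toPre h).surjective t
  rw [LinearEquiv.conj_apply_apply, LinearEquiv.symm_apply_apply, norm_toPre, norm_toPre]
  calc √(E.tensorForm (f t) (f t)) ≤ √(C ^ 2 * E.tensorForm t t) := Real.sqrt_le_sqrt (hf t)
    _ = C * √(E.tensorForm t t) := by rw [Real.sqrt_mul (sq_nonneg C), Real.sqrt_sq hC]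

/-- The left action of `a ∈ 𝓑` on `𝓗`: the continuous extension of `leftMul a`. -/
noncomputable def leftAct (h : E.TensorPos) (hL : E.LeftBounded) (a : E.bdd) :
    Hilb h →L[ℝ] Hilb h :=
  (((toPre h).conj (E.leftMul a)).mkContinuous (supNorm a)
    (pre_bound h _ ENNReal.toReal_nonneg (hL a))).completion

/-- The right action of `a ∈ 𝓑` on `𝓗`: the continuous extension of `rightMul a`. -/
noncomputable def rightAct (h : E.TensorPos) (hR : E.RightBounded) (a : E.bdd) :
    Hilb h →L[ℝ] Hilb h :=
  (((toPre h).conj (E.rightMul a)).mkContinuous (supNorm a)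
    (pre_bound h _ ENNReal.toReal_nonneg (hR a))).completion

lemma leftAct_toHilb (h : E.TensorPos) (hL : E.LeftBounded) (a : E.bdd) (t : E.bdd ⊗[ℝ] E.bdd) :
    leftAct h hL a (toHilb h t) = toHilb h (E.leftMul a t) :=
  ContinuousLinearMap.completion_apply_coe _ (toPre h t)

lemma rightAct_toHilb (h : E.TensorPos) (hR : E.RightBounded) (a : E.bdd)
    (t : E.bdd ⊗[ℝ] E.bdd) :
    rightAct h hR a (toHilb h t) = toHilb h (E.rightMul a t) :=
  ContinuousLinearMap.completion_apply_coe _ (toPre h t)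

lemma denseRange_toHilb (h : E.TensorPos) : DenseRange (toHilb h) :=
  UniformSpace.Completion.denseRange_coe (α := PreHilbert h)

end General

/-! ### Conservative, strongly local and regular forms on a compact metric space -/

section Topological

variable {X : Type*} [MetricSpace X] [CompactSpace X] [MeasurableSpace X] {μ : Measure X}

/-- `𝓔(a, b) = 0` whenever `a` or `b` is (almost everywhere) constant. -/
def Conservative (E : DirichletForm μ) : Prop :=
  ∀ a b : E.domain, ((∃ k : ℝ, E.Rep a fun _ => k) ∨ ∃ k : ℝ, E.Rep b fun _ => k) →
    E.form a b = 0

/-- The support of an almost-everywhere defined function `f` (the support of the measure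
`|f| μ`): the points no neighbourhood of which carries `f = 0` almost everywhere. -/
def aeSupport (μ : Measure X) (f : X → ℝ) : Set X :=
  {x | ∀ U ∈ 𝓝 x, ¬ ∀ᵐ y ∂μ, y ∈ U → f y = 0}

/-- `𝓔(a, b) = 0` whenever `a` is constant on a neighbourhood of the support of `b`, or
vice versa. -/
def StronglyLocal (E : DirichletForm μ) : Prop :=
  ∀ (a b : E.domain) (U : Set X) (k : ℝ), IsOpen U →
    ((aeSupport μ ((b : Lp ℝ 2 μ) : X → ℝ) ⊆ U ∧
        ∀ᵐ x ∂μ, x ∈ U → ((a : Lp ℝ 2 μ) : X → ℝ) x = k) ∨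
      (aeSupport μ ((a : Lp ℝ 2 μ) : X → ℝ) ⊆ U ∧
        ∀ᵐ x ∂μ, x ∈ U → ((b : Lp ℝ 2 μ) : X → ℝ) x = k)) →
    E.form a b = 0

/-- `𝓕 ∩ C(X)`: the continuous functions whose almost-everywhere class lies in the domain. -/
def contDomain (E : DirichletForm μ) : Submodule ℝ C(X, ℝ) where
  carrier := {g | ∃ u : E.domain, E.Rep u g}
  zero_mem' := ⟨0, Lp.coeFn_zero ℝ 2 μ⟩
  add_mem' := by
    rintro f g ⟨u, hu⟩ ⟨v, hv⟩
    exact ⟨u + v, hu.add hv⟩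
  smul_mem' := by
    rintro c f ⟨u, hu⟩
    exact ⟨c • u, hu.smul c⟩

/-- `𝓕 ∩ C(X)` contains a subspace that is dense in `C(X)` for the supremum norm and dense in the
domain for the norm `(𝓔(a, a) + ‖a‖²)^(1/2)`. -/
def Regular (E : DirichletForm μ) : Prop :=
  ∃ D : Submodule ℝ C(X, ℝ), D ≤ E.contDomain ∧ Dense (D : Set C(X, ℝ)) ∧
    ∀ (u : E.domain) (ε : ℝ), 0 < ε → ∃ g ∈ D, ∃ v : E.domain, E.Rep v g ∧
      E.form (u - v) (u - v) + ‖u - v‖ ^ 2 < ε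

/-- On a compact space the constant function `1` belongs to the domain of a regular form. -/
lemma Regular.exists_one {E : DirichletForm μ} (hE : E.Regular) :
    ∃ e : E.bdd, fn e =ᵐ[μ] fun _ => (1 : ℝ) := by
  obtain ⟨D, hD, hdense, -⟩ := hE
  obtain ⟨g, hg, hgD⟩ := hdense.exists_dist_lt (ContinuousMap.const X (2 : ℝ)) one_pos
  obtain ⟨u, hu⟩ := hD hg
  obtain ⟨v, hv, -⟩ := E.markov u
  have h1 : ((v : Lp ℝ 2 μ) : X → ℝ) =ᵐ[μ] fun _ => (1 : ℝ) := by
    unfold Rep at hu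
    filter_upwards [hv, hu] with x hx hux
    have hd := (ContinuousMap.dist_apply_le_dist (f := ContinuousMap.const X (2 : ℝ)) (g := g)
      x).trans_lt hgD
    rw [ContinuousMap.const_apply, Real.dist_eq, abs_lt] at hd
    rw [hx, hux]
    rw [max_eq_left (by linarith), min_eq_left (by linarith)]
  refine ⟨⟨v, v.2, ?_⟩, h1⟩
  rw [eLpNorm_congr_ae h1]
  exact (memLp_top_const (1 : ℝ)).2

/-- The constant function `𝟙` as an element of `𝓑`. -/
noncomputable def Regular.one {E : DirichletForm μ} (hE : E.Regular) : E.bdd :=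
  hE.exists_one.choose

/-- The derivation `∂ a = a ⊗ 𝟙`. -/
noncomputable def deriv {E : DirichletForm μ} (hE : E.Regular) (h : E.TensorPos) (a : E.bdd) :
    Hilb h :=
  toHilb h (a ⊗ₜ[ℝ] hE.one)

end Topological

end DirichletForm

/-! The functional `jump`, `u ⊗ v ↦ -𝓔(u, v)`, behaves like integration over pairs `(x, y)`: a
tensor `∑ uᵢ ⊗ vᵢ` is read as the kernel `∑ uᵢ(x) vᵢ(y)`. It is non-negative on kernels that are
non-negative and vanish on the diagonal (`sum_energy_nonpos`, `jump_nonneg`). Indeed `𝓔(u, v)` is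
the limit of `(n + 1) ⟨v - Rₙ v, u⟩`, where the normalized resolvent `Rₙ` preserves positivity and,
by conservativeness, fixes `𝟙`. The diagonal terms cancel, and what remains is the integral of the
kernel against `Rₙ`.

Sending `a ⊗ b` to the kernel `(a(x) - a(y)) b(x)` turns the form on `𝓑 ⊗ 𝓑` into half of `jump` of
a product of kernels (`tensorForm_eq`), the right action into multiplication by `a(x)`, and the left
action into multiplication by `a(y)`. Positivity and both norm bounds are then pointwise
inequalities between kernels.

The commutator of `a` with `b ⊗ c` has kernel `-(a(x) - a(y)) (b(x) - b(y)) c(x)`, whose square is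
controlled by the fourth powers of the increments of `a` and `b`. It remains to show that `jump` of
such a fourth power is at most zero. For a continuous function, cut the range into thin layers:
non-adjacent layers have zero mutual energy by strong locality, and adjacent ones contribute a
multiple of `h²`, with `h` the height of a layer. The fourth power is used because a bound of `(a(x)
- a(y))²` by `9 h²` plus far terms does not vanish on the diagonal; a further factor `(a(x) -
a(y))²` repairs this and costs only the finite energy of `a`. Regularity extends the result to all
of `𝓑`. -/

namespace DirichletForm

/-! ### The resolvent of the form: construction, positivity, convergence. -/

section Resolvent

variable {X : Type*} [MeasurableSpace X] {μ : Measure X} (E : DirichletForm μ)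

/-- The domain of the form with the inner product `𝓔(u, v) + (n + 1) ⟨u, v⟩`. -/
def EnergyDomain (_ : ℕ) : Type _ := E.domain

instance (n : ℕ) : AddCommGroup (E.EnergyDomain n) := inferInstanceAs (AddCommGroup E.domain)

instance (n : ℕ) : Module ℝ (E.EnergyDomain n) := inferInstanceAs (Module ℝ E.domain)

/-- The identity map from the domain to `EnergyDomain`. -/
def toEnergy (n : ℕ) : E.domain ≃ₗ[ℝ] E.EnergyDomain n := LinearEquiv.refl ℝ E.domain

/-- The bilinear form `𝓔(u, v) + (n + 1) ⟨u, v⟩` on the domain. -/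
noncomputable def energyForm (n : ℕ) (u v : E.domain) : ℝ :=
  E.form u v + (n + 1) * inner ℝ (u : Lp ℝ 2 μ) (v : Lp ℝ 2 μ)

/-- The inner product `𝓔(u, v) + (n + 1) ⟨u, v⟩` on the domain. -/
@[reducible] noncomputable def energyCore (n : ℕ) :
    InnerProductSpace.Core ℝ (E.EnergyDomain n) where
  inner u v := E.energyForm n ((E.toEnergy n).symm u) ((E.toEnergy n).symm v)
  conj_inner_symm u v := by
    simp only [conj_trivial, energyForm]
    rw [E.symm, real_inner_comm]
  re_inner_nonneg u := by
    have := E.nonneg ((E.toEnergy n).symm u)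
    simp only [RCLike.re_to_real, energyForm, real_inner_self_eq_norm_sq]
    positivity
  add_left u v w := by
    simp only [energyForm, map_add, LinearMap.add_apply, Submodule.coe_add, inner_add_left]
    ring
  smul_left u v r := by
    simp only [energyForm, map_smul, LinearMap.smul_apply, Submodule.coe_smul, inner_smul_left,
      conj_trivial, smul_eq_mul]
    ring
  definite u h := by
    have h1 := E.nonneg ((E.toEnergy n).symm u)
    simp only [energyForm, real_inner_self_eq_norm_sq] at h
    have h3 : ‖((E.toEnergy n).symm u : Lp ℝ 2 μ)‖ ^ 2 = 0 := by
      have hn : (0 : ℝ) ≤ n := n.cast_nonneg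
      have h2 := sq_nonneg ‖((E.toEnergy n).symm u : Lp ℝ 2 μ)‖
      nlinarith [mul_nonneg hn h2]
    rw [pow_eq_zero_iff two_ne_zero, norm_eq_zero] at h3
    exact (LinearEquiv.map_eq_zero_iff _).1 (Subtype.ext h3)

noncomputable instance (n : ℕ) : NormedAddCommGroup (E.EnergyDomain n) :=
  @InnerProductSpace.Core.toNormedAddCommGroup ℝ (E.EnergyDomain n) _ _ _ (E.energyCore n)

noncomputable instance (n : ℕ) : InnerProductSpace ℝ (E.EnergyDomain n) :=
  @InnerProductSpace.ofCore ℝ (E.EnergyDomain n) _ _ _ (E.energyCore n).toCore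

lemma inner_toEnergy (n : ℕ) (u v : E.domain) :
    inner ℝ (E.toEnergy n u) (E.toEnergy n v)
      = E.form u v + (n + 1) * inner ℝ (u : Lp ℝ 2 μ) (v : Lp ℝ 2 μ) := rfl

lemma norm_sq_toEnergy (n : ℕ) (u : E.domain) :
    ‖E.toEnergy n u‖ ^ 2 = E.form u u + (n + 1) * ‖u‖ ^ 2 := by
  rw [← real_inner_self_eq_norm_sq, inner_toEnergy, real_inner_self_eq_norm_sq]
  rfl

/-- Closedness is completeness for the weight `1`. The weight `n + 1` gives an equivalent norm,
since `𝓔 + ‖·‖² ≤ 𝓔 + (n + 1) ‖·‖² ≤ (n + 1) (𝓔 + ‖·‖²)`. -/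
instance (n : ℕ) : CompleteSpace (E.EnergyDomain n) := by
  refine Metric.complete_of_cauchySeq_tendsto fun u hu => ?_
  set w : ℕ → E.domain := fun k => (E.toEnergy n).symm (u k) with hw
  have hn : (0 : ℝ) ≤ n := n.cast_nonneg
  have huw : ∀ k, u k = E.toEnergy n (w k) := fun k => by simp [hw]
  obtain ⟨v, hv⟩ := E.closed w fun ε hε => by
    obtain ⟨N, hN⟩ := Metric.cauchySeq_iff.1 hu (√ε) (Real.sqrt_pos.2 hε)
    refine ⟨N, fun i j hi hj => ?_⟩
    have h := hN i hi j hj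
    rw [dist_eq_norm, huw, huw, ← map_sub, Real.lt_sqrt (norm_nonneg _), norm_sq_toEnergy] at h
    nlinarith [sq_nonneg ‖w i - w j‖]
  refine ⟨E.toEnergy n v, ?_⟩
  rw [tendsto_iff_norm_sub_tendsto_zero]
  have h1 : Tendsto (fun k => ‖u k - E.toEnergy n v‖ ^ 2) atTop (𝓝 0) := by
    have hv2 := hv.const_mul ((n : ℝ) + 1)
    rw [mul_zero] at hv2
    refine squeeze_zero (fun k => by positivity) (fun k => ?_) hv2
    rw [huw, ← map_sub, norm_sq_toEnergy, mul_add]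
    have h3 := E.nonneg (w k - v)
    have h4 := mul_nonneg hn h3
    linarith
  have h2 := (Real.continuous_sqrt.tendsto 0).comp h1
  simpa [Function.comp_def, Real.sqrt_sq (norm_nonneg _)] using h2

/-- The inclusion of the domain into `L²`. -/
noncomputable def energyIncl (n : ℕ) : E.EnergyDomain n →L[ℝ] Lp ℝ 2 μ :=
  (E.domain.subtype ∘ₗ (E.toEnergy n).symm.toLinearMap).mkContinuous 1 fun u => by
    obtain ⟨u, rfl⟩ := (E.toEnergy n).surjective u
    have h := E.norm_sq_toEnergy n u
    have h1 := E.nonneg u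
    have hn : (0 : ℝ) ≤ n := n.cast_nonneg
    rw [one_mul]
    refine le_of_sq_le_sq ?_ (norm_nonneg _)
    change ‖u‖ ^ 2 ≤ _
    nlinarith [mul_nonneg hn (sq_nonneg ‖u‖)]

lemma energyIncl_toEnergy (n : ℕ) (u : E.domain) : E.energyIncl n (E.toEnergy n u) = u := rfl

/-- The normalized resolvent `(n + 1) G_{n + 1}` of the form, with values in the domain. -/
noncomputable def resolvent (n : ℕ) : Lp ℝ 2 μ →ₗ[ℝ] E.domain :=
  (E.toEnergy n).symm.toLinearMap ∘ₗ
    (((n : ℝ) + 1) • ContinuousLinearMap.adjoint (E.energyIncl n)).toLinearMap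

/-- This is the weak resolvent equation `𝓔(w, v) + (n + 1) ⟨w, v⟩ = (n + 1) ⟨f, v⟩`, which is the
defining property of the adjoint of the inclusion. -/
lemma form_resolvent (n : ℕ) (f : Lp ℝ 2 μ) (v : E.domain) :
    E.form (E.resolvent n f) v
      = (n + 1) * inner ℝ (f - (E.resolvent n f : Lp ℝ 2 μ)) (v : Lp ℝ 2 μ) := by
  have h := E.inner_toEnergy n (E.resolvent n f) v
  have h2 : inner ℝ (E.toEnergy n (E.resolvent n f)) (E.toEnergy n v)
      = ((n : ℝ) + 1) * inner ℝ f (v : Lp ℝ 2 μ) := by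
    have e : E.toEnergy n (E.resolvent n f)
        = ((n : ℝ) + 1) • ContinuousLinearMap.adjoint (E.energyIncl n) f := by
      simp [resolvent]
    rw [e, inner_smul_left, ContinuousLinearMap.adjoint_inner_left, energyIncl_toEnergy]
    simp
  rw [inner_sub_left]
  linarith

/-- The normalized resolvent of `f` minimizes `v ↦ 𝓔(v, v) + (n + 1) ‖v - f‖²`. -/
lemma resolvent_minimizes (n : ℕ) (f : Lp ℝ 2 μ) (v : E.domain) :
    E.form v v + (n + 1) * ‖(v : Lp ℝ 2 μ) - f‖ ^ 2
      = E.form (E.resolvent n f) (E.resolvent n f)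
        + (n + 1) * ‖(E.resolvent n f : Lp ℝ 2 μ) - f‖ ^ 2
        + (E.form (v - E.resolvent n f) (v - E.resolvent n f)
          + (n + 1) * ‖(v : Lp ℝ 2 μ) - (E.resolvent n f : Lp ℝ 2 μ)‖ ^ 2) := by
  set w := E.resolvent n f with hw
  have h := E.form_resolvent n f (v - w)
  rw [← hw] at h
  have e : (v : Lp ℝ 2 μ) - f = ((v - w : E.domain) : Lp ℝ 2 μ) - (f - (w : Lp ℝ 2 μ)) := by
    simp
  rw [e, norm_sub_sq_real, ← norm_neg ((w : Lp ℝ 2 μ) - f), neg_sub,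
    real_inner_comm, Submodule.coe_sub]
  rw [Submodule.coe_sub] at h
  have hs := E.symm v w
  simp only [map_sub, LinearMap.sub_apply] at h ⊢
  linarith

/-- Truncating the resolvent to `[0, s]` does not increase its energy, and brings it no farther from
`f`, which takes values in `[0, s]`. The minimizer being unique, it equals its truncation. -/
lemma resolvent_nonneg (n : ℕ) {f : Lp ℝ 2 μ} {s : ℝ} (hs : 0 < s)
    (hf : ∀ᵐ x ∂μ, 0 ≤ f x ∧ f x ≤ s) :
    ∀ᵐ x ∂μ, 0 ≤ (E.resolvent n f : Lp ℝ 2 μ) x := by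
  set w := E.resolvent n f with hw
  obtain ⟨v, hv, hle⟩ := E.exists_trunc w hs
  have hmin := E.resolvent_minimizes n f v
  rw [← hw] at hmin
  have hn : (0 : ℝ) ≤ n := n.cast_nonneg
  have hnorm : ‖(v : Lp ℝ 2 μ) - f‖ ≤ ‖(w : Lp ℝ 2 μ) - f‖ := by
    refine Lp.norm_le_norm_of_ae_le ?_
    unfold Rep at hv
    filter_upwards [hv, hf, Lp.coeFn_sub (v : Lp ℝ 2 μ) f, Lp.coeFn_sub (w : Lp ℝ 2 μ) f]
      with x h1 h2 h3 h4
    rw [h3, h4, Pi.sub_apply, Pi.sub_apply, h1, Real.norm_eq_abs, Real.norm_eq_abs]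
    generalize (w : Lp ℝ 2 μ) x = t
    rcases le_total t 0 with h | h
    · rw [max_eq_right h, min_eq_right hs.le, abs_of_nonpos (by linarith),
        abs_of_nonpos (by linarith)]
      linarith
    · rw [max_eq_left h]
      rcases le_total s t with h' | h'
      · rw [min_eq_left h', abs_of_nonneg (by linarith), abs_of_nonneg (by linarith)]
        linarith
      · rw [min_eq_right h']
  have hsq : ‖(v : Lp ℝ 2 μ) - f‖ ^ 2 ≤ ‖(w : Lp ℝ 2 μ) - f‖ ^ 2 := by gcongr
  have h0 : ‖(v : Lp ℝ 2 μ) - (w : Lp ℝ 2 μ)‖ ^ 2 = 0 := by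
    have h1 := E.nonneg (v - w)
    have h2 := sq_nonneg ‖(v : Lp ℝ 2 μ) - (w : Lp ℝ 2 μ)‖
    nlinarith [mul_nonneg hn h2, mul_nonneg hn (sub_nonneg.2 hsq)]
  have hvw : (v : Lp ℝ 2 μ) = w := by
    rw [← sub_eq_zero, ← norm_eq_zero]
    exact pow_eq_zero_iff two_ne_zero |>.1 h0
  unfold Rep at hv
  rw [hvw] at hv
  filter_upwards [hv] with x hx
  rw [hx]
  exact le_min hs.le (le_max_right _ _)

/-- The resolvent fixes the vectors that are orthogonal to the domain for the form. -/
lemma resolvent_eq_self (n : ℕ) {e : E.domain} (he : ∀ v, E.form e v = 0) :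
    E.resolvent n (e : Lp ℝ 2 μ) = e := by
  set w := E.resolvent n (e : Lp ℝ 2 μ) with hw
  have h := E.form_resolvent n (e : Lp ℝ 2 μ) (e - w)
  rw [← hw, ← Submodule.coe_sub, real_inner_self_eq_norm_sq] at h
  have h1 : E.form w (e - w) = - E.form (e - w) (e - w) := by
    have := he (e - w)
    simp only [map_sub, LinearMap.sub_apply] at this ⊢
    linarith
  have h2 := E.nonneg (e - w)
  have hn : (0 : ℝ) ≤ n := n.cast_nonneg
  have h0 : ‖((e - w : E.domain) : Lp ℝ 2 μ)‖ ^ 2 = 0 := by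
    have h3 := sq_nonneg ‖((e - w : E.domain) : Lp ℝ 2 μ)‖
    nlinarith [mul_nonneg hn h3]
  have h4 : ((e - w : E.domain) : Lp ℝ 2 μ) = 0 := by
    rw [← norm_eq_zero]
    exact pow_eq_zero_iff two_ne_zero |>.1 h0
  exact (sub_eq_zero.1 (Subtype.ext h4)).symm

/-- Testing the minimization with `u` itself gives both a uniform energy bound and `L²` convergence,
the squared distance being at most `𝓔(u, u) / (n + 1)`. -/
lemma form_resolvent_self_le (n : ℕ) (u : E.domain) :
    E.form (E.resolvent n (u : Lp ℝ 2 μ)) (E.resolvent n (u : Lp ℝ 2 μ))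
        + (n + 1) * ‖(E.resolvent n (u : Lp ℝ 2 μ) : Lp ℝ 2 μ) - u‖ ^ 2 ≤ E.form u u := by
  have h := E.resolvent_minimizes n (u : Lp ℝ 2 μ) u
  have h1 := E.nonneg (u - E.resolvent n (u : Lp ℝ 2 μ))
  rw [sub_self, norm_zero] at h
  have h2 : 0 ≤ ((n : ℝ) + 1) * ‖(u : Lp ℝ 2 μ) - (E.resolvent n (u : Lp ℝ 2 μ) : Lp ℝ 2 μ)‖ ^ 2 :=
    by positivity
  simp only [ne_eq, OfNat.ofNat_ne_zero, not_false_eq_true, zero_pow, mul_zero, add_zero] at h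
  linarith

lemma tendsto_resolvent (u : E.domain) :
    Tendsto (fun n : ℕ => (E.resolvent n (u : Lp ℝ 2 μ) : Lp ℝ 2 μ) - u) atTop (𝓝 0) := by
  rw [tendsto_zero_iff_norm_tendsto_zero]
  have h1 : Tendsto (fun n : ℕ => ‖(E.resolvent n (u : Lp ℝ 2 μ) : Lp ℝ 2 μ) - u‖ ^ 2)
      atTop (𝓝 0) := by
    have h := (tendsto_one_div_add_atTop_nhds_zero_nat (𝕜 := ℝ)).mul_const (E.form u u)
    rw [zero_mul] at h
    refine squeeze_zero (fun n => by positivity) (fun n => ?_) h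
    have h2 := E.form_resolvent_self_le n u
    have h3 := E.nonneg (E.resolvent n (u : Lp ℝ 2 μ))
    have hn : (0 : ℝ) < (n : ℝ) + 1 := by positivity
    rw [one_div, inv_mul_eq_div, le_div_iff₀ hn]
    linarith
  have h2 := (Real.continuous_sqrt.tendsto 0).comp h1
  simpa [Function.comp_def, Real.sqrt_sq (norm_nonneg _)] using h2

/-- The orthogonal complement of the range of an adjoint is the kernel of the operator, and the
inclusion into `L²` is injective. -/
lemma dense_range_adjoint_energyIncl (n : ℕ) :
    DenseRange (ContinuousLinearMap.adjoint (E.energyIncl n)) := by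
  have h : (LinearMap.range (ContinuousLinearMap.adjoint (E.energyIncl n)).toLinearMap)ᗮ = ⊥ := by
    rw [ContinuousLinearMap.orthogonal_range, ContinuousLinearMap.adjoint_adjoint]
    rw [LinearMap.ker_eq_bot]
    exact fun u v huv => Subtype.ext huv
  have h2 := (Submodule.topologicalClosure_eq_top_iff (𝕜 := ℝ)).2 h
  intro x
  have : x ∈ (LinearMap.range
      (ContinuousLinearMap.adjoint (E.energyIncl n)).toLinearMap).topologicalClosure := by
    rw [h2]; trivial
  exact this

/-- `𝓔((n + 1) G_{n + 1} u, v)` tends to `𝓔(u, v)` on the domain. -/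
lemma tendsto_form_resolvent (u v : E.domain) :
    Tendsto (fun n : ℕ => E.form (E.resolvent n (u : Lp ℝ 2 μ)) v) atTop (𝓝 (E.form u v)) := by
  set x : ℕ → E.domain := fun n => E.resolvent n (u : Lp ℝ 2 μ) - u with hx
  have hx0 : Tendsto (fun n => (x n : Lp ℝ 2 μ)) atTop (𝓝 0) := E.tendsto_resolvent u
  have hin : ∀ f : Lp ℝ 2 μ, Tendsto (fun n => inner ℝ (x n : Lp ℝ 2 μ) f) atTop (𝓝 0) := by
    intro f
    have := hx0.inner (𝕜 := ℝ) (tendsto_const_nhds (x := f))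
    rwa [inner_zero_left] at this
  have hbd : ∃ C : ℝ, 0 < C ∧ ∀ n, ‖E.toEnergy 0 (x n)‖ ≤ C := by
    -- The added `1` makes the bound strictly positive, since it is divided by later.
    refine ⟨√(5 * E.form u u) + 1, by positivity, fun n => ?_⟩
    refine (Real.le_sqrt_of_sq_le ?_).trans (le_add_of_nonneg_right zero_le_one)
    rw [norm_sq_toEnergy]
    have h1 := E.form_resolvent_self_le n u
    have h2 := E.form_sub_le (E.resolvent n (u : Lp ℝ 2 μ)) u
    have h3 : ‖x n‖ = ‖(E.resolvent n (u : Lp ℝ 2 μ) : Lp ℝ 2 μ) - u‖ := rfl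
    have h4 := E.nonneg (E.resolvent n (u : Lp ℝ 2 μ))
    have hn : (0 : ℝ) ≤ n := n.cast_nonneg
    rw [h3, Nat.cast_zero, zero_add, one_mul]
    nlinarith [mul_nonneg hn (sq_nonneg ‖(E.resolvent n (u : Lp ℝ 2 μ) : Lp ℝ 2 μ) - u‖)]
  obtain ⟨C, hC, hbd⟩ := hbd
  -- Weak convergence in the energy space: the sequence is bounded there, and against the dense
  -- range of the adjoint the energy product becomes an `L²` product, which tends to zero.
  have key : Tendsto (fun n => inner ℝ (E.toEnergy 0 (x n)) (E.toEnergy 0 v)) atTop (𝓝 0) := by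
    rw [Metric.tendsto_atTop]
    intro ε hε
    obtain ⟨f, hf⟩ := (E.dense_range_adjoint_energyIncl 0).exists_dist_lt (E.toEnergy 0 v)
      (show 0 < ε / (2 * C) by positivity)
    obtain ⟨N, hN⟩ := Metric.tendsto_atTop.1 (hin f) (ε / 2) (by positivity)
    refine ⟨N, fun n hn => ?_⟩
    have h1 := hN n hn
    rw [dist_zero_right] at h1 ⊢
    set z := ContinuousLinearMap.adjoint (E.energyIncl 0) f with hz
    have e : inner ℝ (E.toEnergy 0 (x n)) (E.toEnergy 0 v)
        = inner ℝ (x n : Lp ℝ 2 μ) f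
          + inner ℝ (E.toEnergy 0 (x n)) (E.toEnergy 0 v - z) := by
      rw [inner_sub_right, hz, ContinuousLinearMap.adjoint_inner_right, energyIncl_toEnergy]
      ring
    rw [e]
    refine (norm_add_le _ _).trans_lt ?_
    have h2 : ‖inner ℝ (E.toEnergy 0 (x n)) (E.toEnergy 0 v - z)‖ ≤ C * (ε / (2 * C)) := by
      refine (norm_inner_le_norm _ _).trans ?_
      rw [← dist_eq_norm]
      gcongr
      exact hbd n
    have h3 : C * (ε / (2 * C)) = ε / 2 := by field_simp
    linarith
  have h := (key.sub (hin (v : Lp ℝ 2 μ))).add_const (E.form u v)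
  rw [sub_zero, zero_add] at h
  refine h.congr fun n => ?_
  rw [inner_toEnergy]
  simp only [hx, map_sub, LinearMap.sub_apply]
  simp

end Resolvent

/-! ### Positivity of the resolvent on kernels, and of the energy. -/

section Positivity

variable {X : Type*} [MeasurableSpace X] {μ : Measure X} (E : DirichletForm μ)

/-- `e` is the constant function `𝟙`, and has no energy. -/
structure IsUnitVector {E : DirichletForm μ} (e : E.bdd) : Prop where
  fn_eq : fn e =ᵐ[μ] fun _ => (1 : ℝ)
  energy_eq : ∀ a : E.bdd, E.energy a e = 0
  form_eq : ∀ v : E.domain, E.form (E.incl e) v = 0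

variable {E} {e : E.bdd}

lemma IsUnitVector.mul_self_eq (he : IsUnitVector e) (a : E.bdd) : a * e = a := bdd_ext (by
  filter_upwards [fn_mul a e, he.fn_eq] with x h1 h2
  rw [h1, h2, mul_one])

lemma IsUnitVector.resolvent_sub_smul (he : IsUnitVector e) (n : ℕ) (f : Lp ℝ 2 μ) (r : ℝ) :
    E.resolvent n (f - r • (e : Lp ℝ 2 μ)) = E.resolvent n f - r • E.incl e := by
  have h0 : E.resolvent n (e : Lp ℝ 2 μ) = E.incl e :=
    E.resolvent_eq_self n (e := E.incl e) he.form_eq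
  rw [map_sub, map_smul, h0]

/-- Since the resolvent fixes `𝟙`, subtracting `r 𝟙` reduces the bound to positivity. The upper
bound `C` only supplies a finite truncation level. -/
lemma IsUnitVector.le_resolvent (he : IsUnitVector e) (n : ℕ) {f : Lp ℝ 2 μ} {r C : ℝ}
    (hf : ∀ᵐ x ∂μ, r ≤ f x ∧ f x ≤ C) : ∀ᵐ x ∂μ, r ≤ (E.resolvent n f : Lp ℝ 2 μ) x := by
  have hs : 0 < |C - r| + 1 := by positivity
  have hfe : ∀ᵐ x ∂μ, 0 ≤ (f - r • (e : Lp ℝ 2 μ)) x ∧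
      (f - r • (e : Lp ℝ 2 μ)) x ≤ |C - r| + 1 := by
    filter_upwards [hf, he.fn_eq, Lp.coeFn_sub f (r • (e : Lp ℝ 2 μ)),
      Lp.coeFn_smul r (e : Lp ℝ 2 μ)] with x h1 h2 h3 h4
    have h5 : (e : Lp ℝ 2 μ) x = 1 := h2
    rw [h3, Pi.sub_apply, h4, Pi.smul_apply, h5, smul_eq_mul, mul_one]
    constructor <;> linarith [h1.1, h1.2, le_abs_self (C - r)]
  have h := E.resolvent_nonneg n hs hfe
  rw [he.resolvent_sub_smul] at h
  have hu : E.Rep (E.incl e) (fun _ => 1) := he.fn_eq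
  have hR : E.Rep (E.resolvent n f) (E.resolvent n f : Lp ℝ 2 μ) := ae_eq_refl _
  have hr := hR.sub (hu.smul r)
  unfold Rep at hr
  filter_upwards [h, hr] with x h1 h2
  rw [h2] at h1
  linarith

lemma ae_abs_le_supNorm (a : E.bdd) : ∀ᵐ x ∂μ, |fn a x| ≤ supNorm a := by
  have h := a.2.2
  rw [eLpNorm_exponent_top] at h
  filter_upwards [enorm_ae_le_eLpNormEssSup (fn a) μ] with x hx
  have := (ENNReal.toReal_le_toReal (by simp) h.ne).2 hx
  simpa only [toReal_enorm, Real.norm_eq_abs, supNorm, eLpNorm_exponent_top] using this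

lemma exists_nat_ae_bound {ι : Type*} [Finite ι] (v : ι → E.bdd) :
    ∃ C : ℕ, ∀ᵐ x ∂μ, ∀ i, |fn (v i) x| ≤ C := by
  cases nonempty_fintype ι
  obtain ⟨C, hC⟩ := exists_nat_ge (∑ i, supNorm (v i))
  refine ⟨C, ?_⟩
  filter_upwards [ae_all_iff.2 fun i => ae_abs_le_supNorm (v i)] with x hx i
  exact ((hx i).trans (Finset.single_le_sum (f := fun i => supNorm (v i))
    (fun _ _ => ENNReal.toReal_nonneg) (Finset.mem_univ i))).trans hC

/-- The resolvent in the second variable preserves positivity of kernels `∑ i, uᵢ(x) vᵢ(y)`. -/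
lemma IsUnitVector.sum_mul_resolvent_nonneg (he : IsUnitVector e) (n : ℕ) {ι : Type*} [Fintype ι]
    (u v : ι → E.bdd) {S : Set X} (hS : S ∈ ae μ)
    (h : ∀ x ∈ S, ∀ y ∈ S, 0 ≤ ∑ i, fn (u i) x * fn (v i) y) :
    ∀ᵐ x ∂μ, 0 ≤ ∑ i, fn (u i) x * (E.resolvent n (v i : Lp ℝ 2 μ) : Lp ℝ 2 μ) x := by
  obtain ⟨C, hC⟩ := exists_nat_ae_bound v
  -- For fixed `x` one would apply `le_resolvent` to `∑ i, uᵢ(x) vᵢ`, but the exceptional null set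
  -- would depend on `x`. Rational coefficients and bounds leave only countably many null sets.
  have hrat : ∀ᵐ x ∂μ, ∀ (q : ι → ℚ) (r : ℚ),
      (∀ y ∈ S, (∀ i, |fn (v i) y| ≤ C) → (r : ℝ) ≤ ∑ i, (q i : ℝ) * fn (v i) y) →
      (r : ℝ) ≤ ∑ i, (q i : ℝ) * (E.resolvent n (v i : Lp ℝ 2 μ) : Lp ℝ 2 μ) x := by
    rw [ae_all_iff]; intro q
    rw [ae_all_iff]; intro r
    by_cases hq : ∀ y ∈ S, (∀ i, |fn (v i) y| ≤ C) → (r : ℝ) ≤ ∑ i, (q i : ℝ) * fn (v i) y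
    swap
    · exact Eventually.of_forall fun x hx => absurd hx hq
    have hsum := Rep.sum Finset.univ (E := E) (u := fun i => (q i : ℝ) • E.incl (v i))
      (f := fun i x => (q i : ℝ) * fn (v i) x)
      (fun i => Rep.smul _ (show E.Rep (E.incl (v i)) _ from EventuallyEq.rfl))
    have hsum' := Rep.sum Finset.univ (E := E)
      (u := fun i => (q i : ℝ) • E.resolvent n (v i : Lp ℝ 2 μ))
      (f := fun i x => (q i : ℝ) * (E.resolvent n (v i : Lp ℝ 2 μ) : Lp ℝ 2 μ) x)
      (fun i => Rep.smul _ EventuallyEq.rfl)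
    have e1 : E.resolvent n ((∑ i, (q i : ℝ) • E.incl (v i) : E.domain) : Lp ℝ 2 μ)
        = ∑ i, (q i : ℝ) • E.resolvent n (v i : Lp ℝ 2 μ) := by
      rw [Submodule.coe_sum, map_sum]
      refine Finset.sum_congr rfl fun i _ => ?_
      rw [Submodule.coe_smul, map_smul]
      rfl
    unfold Rep at hsum hsum'
    have hle := he.le_resolvent n
      (f := ((∑ i, (q i : ℝ) • E.incl (v i) : E.domain) : Lp ℝ 2 μ)) (r := r)
      (C := ∑ i, |(q i : ℝ)| * C) (by
        filter_upwards [hsum, hS, hC] with x h1 h2 h3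
        rw [h1]
        refine ⟨hq x h2 h3, Finset.sum_le_sum fun i _ => ?_⟩
        refine (le_abs_self _).trans ?_
        rw [abs_mul]
        gcongr
        exact h3 i)
    filter_upwards [hle, hsum'] with x h1 h2 _
    rw [e1, h2] at h1
    exact h1
  filter_upwards [hrat, hS] with x hx hxS
  by_contra! hneg
  set R : ι → ℝ := fun i => (E.resolvent n (v i : Lp ℝ 2 μ) : Lp ℝ 2 μ) x with hR
  -- Rounding each `uᵢ(x)` to a rational within `ε` costs `ε ∑ C` on the side of the `vᵢ` and `ε ∑
  -- |Rᵢ|` on the side of their resolvents. With `ε K` below the supposed deficit, this cannot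
  -- restore the sign.
  set K : ℝ := ∑ _i : ι, (C : ℝ) + ∑ i, |R i| + 1 with hK
  have hKpos : 0 < K := by positivity
  obtain ⟨ε, hε0, hε⟩ := exists_rat_btwn
    (show 0 < -(∑ i, fn (u i) x * R i) / K from div_pos (by linarith) hKpos)
  rw [lt_div_iff₀ hKpos] at hε
  have hex : ∀ i, ∃ q : ℚ, |(q : ℝ) - fn (u i) x| ≤ ε := fun i => by
    obtain ⟨q, h1, h2⟩ := exists_rat_btwn (show fn (u i) x < fn (u i) x + ε by linarith)
    exact ⟨q, by rw [abs_of_pos (by linarith)]; linarith⟩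
  choose q hq using hex
  have hlow : ∀ w : ι → ℝ, ∑ i, fn (u i) x * w i - ε * ∑ i, |w i| ≤ ∑ i, (q i : ℝ) * w i ∧
      ∑ i, (q i : ℝ) * w i ≤ ∑ i, fn (u i) x * w i + ε * ∑ i, |w i| := by
    intro w
    have hd : |∑ i, (q i : ℝ) * w i - ∑ i, fn (u i) x * w i| ≤ ε * ∑ i, |w i| := by
      rw [← Finset.sum_sub_distrib, Finset.mul_sum]
      refine (Finset.abs_sum_le_sum_abs _ _).trans (Finset.sum_le_sum fun i _ => ?_)
      rw [← sub_mul, abs_mul]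
      gcongr
      exact hq i
    rw [abs_le] at hd
    constructor <;> linarith [hd.1, hd.2]
  have h1 := hx q (-(ε * ∑ _i : ι, (C : ℚ))) (fun y hy hyC => by
    have h2 := (hlow fun i => fn (v i) y).1
    have h3 := h x hxS y hy
    have h4 : ε * ∑ i, |fn (v i) y| ≤ ε * ∑ _i : ι, (C : ℝ) := by
      gcongr with i
      exact hyC i
    push_cast
    linarith)
  have h2 := (hlow R).2
  have h3 : ε * K = ε * ∑ _i : ι, (C : ℝ) + ε * ∑ i, |R i| + ε := by rw [hK]; ring
  push_cast at h1
  have h4 : ∑ i, (q i : ℝ) * R i = ∑ i, (q i : ℝ) *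
    (E.resolvent n (v i : Lp ℝ 2 μ) : Lp ℝ 2 μ) x := rfl
  linarith

/-- By `form_resolvent` the approximating sum is `(n + 1) ∫ ∑ (uᵢ vᵢ - uᵢ Rₙ vᵢ)`. The first part
vanishes by the diagonal condition, and the second has a sign by `sum_mul_resolvent_nonneg`. -/
lemma IsUnitVector.sum_energy_nonpos (he : IsUnitVector e) {ι : Type*} [Fintype ι]
    (u v : ι → E.bdd) {S : Set X} (hS : S ∈ ae μ)
    (h : ∀ x ∈ S, ∀ y ∈ S, 0 ≤ ∑ i, fn (u i) x * fn (v i) y)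
    (hdiag : ∀ x ∈ S, ∑ i, fn (u i) x * fn (v i) x = 0) :
    ∑ i, E.energy (u i) (v i) ≤ 0 := by
  have hlim : Tendsto (fun n : ℕ => ∑ i, E.form (E.resolvent n (v i : Lp ℝ 2 μ)) (E.incl (u i)))
      atTop (𝓝 (∑ i, E.energy (u i) (v i))) := by
    refine tendsto_finsetSum _ fun i _ => ?_
    rw [energy_symm]
    exact E.tendsto_form_resolvent (E.incl (v i)) (E.incl (u i))
  refine le_of_tendsto' hlim fun n => ?_
  have e1 : ∑ i, E.form (E.resolvent n (v i : Lp ℝ 2 μ)) (E.incl (u i))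
      = (n + 1) * ∑ i, inner ℝ ((v i : Lp ℝ 2 μ) - (E.resolvent n (v i : Lp ℝ 2 μ) : Lp ℝ 2 μ))
        (u i : Lp ℝ 2 μ) := by
    rw [Finset.mul_sum]
    exact Finset.sum_congr rfl fun i _ => E.form_resolvent n _ _
  rw [e1]
  refine mul_nonpos_of_nonneg_of_nonpos (by positivity) ?_
  simp only [L2.inner_def]
  rw [← integral_finsetSum _ fun i _ => L2.integrable_inner _ _]
  refine integral_nonpos_of_ae ?_
  filter_upwards [he.sum_mul_resolvent_nonneg n u v hS h, hS, ae_all_iff.2 fun i =>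
    Lp.coeFn_sub (v i : Lp ℝ 2 μ) (E.resolvent n (v i : Lp ℝ 2 μ) : Lp ℝ 2 μ)] with x h1 h2 h3
  have h4 := hdiag x h2
  have e2 : ∀ i, inner ℝ (((v i : Lp ℝ 2 μ) - (E.resolvent n (v i : Lp ℝ 2 μ) : Lp ℝ 2 μ) :
      Lp ℝ 2 μ) x) ((u i : Lp ℝ 2 μ) x)
      = fn (u i) x * fn (v i) x
        - fn (u i) x * (E.resolvent n (v i : Lp ℝ 2 μ) : Lp ℝ 2 μ) x := by
    intro i
    rw [h3 i, Pi.sub_apply]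
    simp only [RCLike.inner_apply, conj_trivial]
    ring
  simp only [e2, Finset.sum_sub_distrib, h4, Pi.zero_apply]
  linarith

/-! ### Tensors as kernels, and the semi-inner product in terms of them. -/

/-- The tensor `t = ∑ i, uᵢ ⊗ vᵢ` represents the kernel `K(x, y) = ∑ i, uᵢ(x) vᵢ(y)`, up to
null sets of `x` and of `y`. -/
def TensorRep (t : E.bdd ⊗[ℝ] E.bdd) (K : X → X → ℝ) : Prop :=
  ∃ (ι : Type) (_ : Fintype ι) (u v : ι → E.bdd), t = ∑ i, u i ⊗ₜ[ℝ] v i ∧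
    ∃ S ∈ ae μ, ∀ x ∈ S, ∀ y ∈ S, K x y = ∑ i, fn (u i) x * fn (v i) y

lemma tensorRep_tmul {a b : E.bdd} {f g : X → ℝ} (ha : fn a =ᵐ[μ] f) (hb : fn b =ᵐ[μ] g) :
    TensorRep (a ⊗ₜ[ℝ] b) (fun x y => f x * g y) := by
  refine ⟨Unit, inferInstance, fun _ => a, fun _ => b, by simp, _,
    inter_mem ha hb, fun x hx y hy => ?_⟩
  simp only [Finset.univ_unique, Finset.sum_const, Finset.card_singleton, one_smul]
  rw [show fn a x = f x from hx.1, show fn b y = g y from hy.2]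

lemma TensorRep.add {s t : E.bdd ⊗[ℝ] E.bdd} {K L : X → X → ℝ} (hs : TensorRep s K)
    (ht : TensorRep t L) : TensorRep (s + t) (fun x y => K x y + L x y) := by
  obtain ⟨ι, _, u, v, rfl, S, hS, h⟩ := hs
  obtain ⟨κ, _, u', v', rfl, S', hS', h'⟩ := ht
  refine ⟨ι ⊕ κ, inferInstance, Sum.elim u u', Sum.elim v v', by simp, _, inter_mem hS hS',
    fun x hx y hy => ?_⟩
  beta_reduce
  rw [h x hx.1 y hy.1, h' x hx.2 y hy.2]
  simp

lemma TensorRep.smul {t : E.bdd ⊗[ℝ] E.bdd} {K : X → X → ℝ} (c : ℝ) (ht : TensorRep t K) :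
    TensorRep (c • t) (fun x y => c * K x y) := by
  obtain ⟨ι, _, u, v, rfl, S, hS, h⟩ := ht
  have hc := ae_all_iff.2 fun i => fn_smul c (u i)
  refine ⟨ι, inferInstance, fun i => c • u i, v, ?_, _, inter_mem hS hc, fun x hx y hy => ?_⟩
  · rw [Finset.smul_sum]
    rfl
  · beta_reduce
    rw [h x hx.1 y hy.1, Finset.mul_sum]
    refine Finset.sum_congr rfl fun i _ => ?_
    rw [show fn (c • u i) x = c * fn (u i) x from hx.2 i, mul_assoc]

lemma TensorRep.sub {s t : E.bdd ⊗[ℝ] E.bdd} {K L : X → X → ℝ} (hs : TensorRep s K)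
    (ht : TensorRep t L) : TensorRep (s - t) (fun x y => K x y - L x y) := by
  have h := hs.add (ht.smul (-1))
  have e1 : s + (-1 : ℝ) • t = s - t := by module
  rw [e1] at h
  convert h using 3
  ring

lemma TensorRep.mul {s t : E.bdd ⊗[ℝ] E.bdd} {K L : X → X → ℝ} (hs : TensorRep s K)
    (ht : TensorRep t L) : TensorRep (s * t) (fun x y => K x y * L x y) := by
  obtain ⟨ι, _, u, v, rfl, S, hS, h⟩ := hs
  obtain ⟨κ, _, u', v', rfl, S', hS', h'⟩ := ht
  have hu := ae_all_iff.2 fun p : ι × κ => fn_mul (u p.1) (u' p.2)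
  have hv := ae_all_iff.2 fun p : ι × κ => fn_mul (v p.1) (v' p.2)
  refine ⟨ι × κ, inferInstance, fun p => u p.1 * u' p.2, fun p => v p.1 * v' p.2, ?_, _,
    inter_mem (inter_mem hS hS') (inter_mem hu hv), fun x hx y hy => ?_⟩
  · rw [Finset.sum_mul_sum, Fintype.sum_prod_type]
    simp only [Algebra.TensorProduct.tmul_mul_tmul]
  · beta_reduce
    rw [h x hx.1.1 y hy.1.1, h' x hx.1.2 y hy.1.2, Finset.sum_mul_sum, Fintype.sum_prod_type]
    refine Finset.sum_congr rfl fun i _ => Finset.sum_congr rfl fun j _ => ?_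
    rw [show fn (u i * u' j) x = _ from hx.2.1 (i, j), show fn (v i * v' j) y = _ from
      hy.2.2 (i, j)]
    ring

lemma TensorRep.congr {t : E.bdd ⊗[ℝ] E.bdd} {K L : X → X → ℝ} (ht : TensorRep t K)
    (h : ∃ S ∈ ae μ, ∀ x ∈ S, ∀ y ∈ S, L x y = K x y) : TensorRep t L := by
  obtain ⟨ι, _, u, v, e1, S, hS, hK⟩ := ht
  obtain ⟨S', hS', hL⟩ := h
  exact ⟨ι, inferInstance, u, v, e1, _, inter_mem hS hS', fun x hx y hy =>
    (hL x hx.2 y hy.2).trans (hK x hx.1 y hy.1)⟩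

lemma tensorRep_zero : TensorRep (0 : E.bdd ⊗[ℝ] E.bdd) (fun _ _ => 0) :=
  ⟨Empty, inferInstance, fun i => i.elim, fun i => i.elim, by simp, Set.univ, univ_mem, by simp⟩

lemma TensorRep.sum {α : Type*} (s : Finset α) {t : α → E.bdd ⊗[ℝ] E.bdd} {K : α → X → X → ℝ}
    (h : ∀ i ∈ s, TensorRep (t i) (K i)) :
    TensorRep (∑ i ∈ s, t i) (fun x y => ∑ i ∈ s, K i x y) := by
  classical
  induction s using Finset.induction_on with
  | empty => simpa using tensorRep_zero
  | insert a s ha ih =>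
    simp only [Finset.sum_insert ha]
    exact (h a (Finset.mem_insert_self _ _)).add
      (ih fun i hi => h i (Finset.mem_insert_of_mem hi))

variable (E) in
/-- The functional `u ⊗ v ↦ -𝓔(u, v)`: it integrates kernels vanishing on the diagonal against
the limit of the (rescaled) transition measures. -/
noncomputable def jump : E.bdd ⊗[ℝ] E.bdd →ₗ[ℝ] ℝ := -TensorProduct.lift E.energy

lemma jump_tmul (a b : E.bdd) : E.jump (a ⊗ₜ[ℝ] b) = -E.energy a b := rfl

lemma IsUnitVector.jump_nonneg (he : IsUnitVector e) {t : E.bdd ⊗[ℝ] E.bdd} {K : X → X → ℝ}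
    (ht : TensorRep t K) {S : Set X} (hS : S ∈ ae μ) (h : ∀ x ∈ S, ∀ y ∈ S, 0 ≤ K x y)
    (hdiag : ∀ x ∈ S, K x x = 0) : 0 ≤ E.jump t := by
  obtain ⟨ι, _, u, v, rfl, S', hS', hK⟩ := ht
  have h1 := he.sum_energy_nonpos u v (inter_mem hS hS')
    (fun x hx y hy => by rw [← hK x hx.2 y hy.2]; exact h x hx.1 y hy.1)
    (fun x hx => by rw [← hK x hx.2 x hx.2]; exact hdiag x hx.1)
  simp only [map_sum, jump_tmul, Finset.sum_neg_distrib]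
  linarith

lemma IsUnitVector.jump_mono (he : IsUnitVector e) {s t : E.bdd ⊗[ℝ] E.bdd} {K L : X → X → ℝ}
    (hs : TensorRep s K) (ht : TensorRep t L) {S : Set X} (hS : S ∈ ae μ)
    (h : ∀ x ∈ S, ∀ y ∈ S, K x y ≤ L x y) (hdiag : ∀ x ∈ S, K x x = L x x) :
    E.jump s ≤ E.jump t := by
  have := he.jump_nonneg (ht.sub hs) hS (fun x hx y hy => sub_nonneg.2 (h x hx y hy))
    (fun x hx => sub_eq_zero.2 (hdiag x hx).symm)
  rw [map_sub] at this
  linarith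

/-- The embedding of `𝓑 ⊗ 𝓑` into kernels: `a ⊗ b` is sent to `(a(x) - a(y)) b(x)`. -/
noncomputable def kernel (e : E.bdd) : E.bdd ⊗[ℝ] E.bdd →ₗ[ℝ] E.bdd ⊗[ℝ] E.bdd :=
  TensorProduct.lift <| LinearMap.mk₂ ℝ (fun a b => (a * b) ⊗ₜ[ℝ] e - b ⊗ₜ[ℝ] a)
    (by intros; simp only [add_mul, TensorProduct.add_tmul, TensorProduct.tmul_add]; abel)
    (by intros; simp only [smul_mul_assoc, TensorProduct.smul_tmul',
          TensorProduct.tmul_smul, smul_sub])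
    (by intros; simp only [mul_add, TensorProduct.add_tmul]; abel)
    (by intros; simp only [mul_smul_comm, TensorProduct.smul_tmul', smul_sub])

lemma kernel_tmul (e a b : E.bdd) : kernel e (a ⊗ₜ[ℝ] b) = (a * b) ⊗ₜ[ℝ] e - b ⊗ₜ[ℝ] a := rfl

lemma IsUnitVector.tensorRep_kernel_tmul (he : IsUnitVector e) (a b : E.bdd) :
    TensorRep (kernel e (a ⊗ₜ[ℝ] b)) (fun x y => (fn a x - fn a y) * fn b x) := by
  have h := (tensorRep_tmul (fn_mul a b) he.fn_eq).sub
    (tensorRep_tmul (EventuallyEq.refl _ (fn b)) (EventuallyEq.refl _ (fn a)))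
  rw [kernel_tmul]
  convert h using 3
  ring

/-- Vanishing on the diagonal makes products with these kernels admissible for `jump_nonneg` and
`jump_mono`. -/
lemma IsUnitVector.exists_tensorRep_kernel (he : IsUnitVector e) (t : E.bdd ⊗[ℝ] E.bdd) :
    ∃ K : X → X → ℝ, TensorRep (kernel e t) K ∧ ∀ x, K x x = 0 := by
  induction t using TensorProduct.induction_on with
  | zero => exact ⟨_, by rw [map_zero]; exact tensorRep_zero, fun _ => rfl⟩
  | tmul a b => exact ⟨_, he.tensorRep_kernel_tmul a b, fun x => by ring⟩
  | add s t hs ht =>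
    obtain ⟨K, hK, hK0⟩ := hs
    obtain ⟨L, hL, hL0⟩ := ht
    exact ⟨_, by rw [map_add]; exact hK.add hL, fun x => by simp [hK0, hL0]⟩

/-- On elementary tensors the product of kernels is `abcd ⊗ 𝟙 - abd ⊗ c - bcd ⊗ a + bd ⊗ ac`. Under
`jump` the first term drops out because `𝟙` has no energy, and the others are the three terms of the
form. -/
lemma IsUnitVector.tensorForm_eq (he : IsUnitVector e) (s t : E.bdd ⊗[ℝ] E.bdd) :
    E.tensorForm s t = (1 / 2 : ℝ) * E.jump (kernel e s * kernel e t) := by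
  induction s using TensorProduct.induction_on with
  | zero => simp
  | add s s' hs hs' => rw [map_add, map_add, LinearMap.add_apply, hs, hs', add_mul, map_add]; ring
  | tmul a b =>
    induction t using TensorProduct.induction_on with
    | zero => simp
    | add t t' ht ht' => rw [map_add, map_add, ht, ht', mul_add, map_add]; ring
    | tmul c d =>
      simp only [kernel_tmul, sub_mul, mul_sub, Algebra.TensorProduct.tmul_mul_tmul, map_sub,
        jump_tmul, tensorForm_tmul, he.mul_self_eq, he.energy_eq]
      rw [mul_comm e c, he.mul_self_eq, mul_comm a c, mul_comm b (c * d), E.energy_symm a]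
      ring

lemma IsUnitVector.kernel_rightMul (he : IsUnitVector e) (a : E.bdd) (t : E.bdd ⊗[ℝ] E.bdd) :
    kernel e (E.rightMul a t) = kernel e t * (a ⊗ₜ[ℝ] e) := by
  induction t using TensorProduct.induction_on with
  | zero => simp
  | add s t hs ht => simp only [map_add, hs, ht, add_mul]
  | tmul b c =>
    simp only [rightMul_tmul, kernel_tmul, sub_mul, Algebra.TensorProduct.tmul_mul_tmul,
      he.mul_self_eq, mul_assoc]

/-- The left action multiplies kernels by `a(y)`, because `(ab)(x) - (ab)(y) - (a(x) - a(y)) b(x) =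
a(y) (b(x) - b(y))`. -/
lemma IsUnitVector.kernel_leftMul (he : IsUnitVector e) (a : E.bdd) (t : E.bdd ⊗[ℝ] E.bdd) :
    kernel e (E.leftMul a t) = kernel e t * (e ⊗ₜ[ℝ] a) := by
  induction t using TensorProduct.induction_on with
  | zero => simp
  | add s t hs ht => simp only [map_add, hs, ht, add_mul]
  | tmul b c =>
    simp only [leftMul_tmul, kernel_tmul, map_sub, sub_mul, Algebra.TensorProduct.tmul_mul_tmul,
      he.mul_self_eq]
    rw [mul_comm e a, he.mul_self_eq, mul_assoc, mul_comm b a]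
    abel

lemma IsUnitVector.tensorPos (he : IsUnitVector e) : E.TensorPos := fun t => by
  obtain ⟨K, hK, hK0⟩ := he.exists_tensorRep_kernel t
  rw [he.tensorForm_eq]
  have := he.jump_nonneg (hK.mul hK) univ_mem (fun x _ y _ => mul_self_nonneg _)
    (fun x _ => by rw [hK0, mul_zero])
  positivity

/-- Pointwise `(K L)² ≤ C² K²`, with both sides zero on the diagonal. Taking `L` to be `a(x)` or
`a(y)` bounds the two actions. -/
lemma IsUnitVector.jump_mul_le (he : IsUnitVector e) (t : E.bdd ⊗[ℝ] E.bdd)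
    {A : E.bdd ⊗[ℝ] E.bdd} {L : X → X → ℝ} (hA : TensorRep A L) {C : ℝ} {S : Set X}
    (hS : S ∈ ae μ) (hL : ∀ x ∈ S, ∀ y ∈ S, |L x y| ≤ C) :
    E.jump ((kernel e t * A) * (kernel e t * A)) ≤ C ^ 2 * E.jump (kernel e t * kernel e t) := by
  obtain ⟨K, hK, hK0⟩ := he.exists_tensorRep_kernel t
  have h := he.jump_mono ((hK.mul hA).mul (hK.mul hA)) ((hK.mul hK).smul (C ^ 2)) hS
    (fun x hx y hy => by
      have h1 : L x y ^ 2 ≤ C ^ 2 := by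
        rw [← sq_abs]
        have := hL x hx y hy
        gcongr
      calc K x y * L x y * (K x y * L x y) = L x y ^ 2 * (K x y * K x y) := by ring
        _ ≤ C ^ 2 * (K x y * K x y) := by gcongr; exact mul_self_nonneg _)
    (fun x _ => by rw [hK0]; ring)
  rwa [map_smul, smul_eq_mul] at h

lemma IsUnitVector.rightBounded (he : IsUnitVector e) : E.RightBounded := fun a t => by
  rw [he.tensorForm_eq, he.tensorForm_eq, he.kernel_rightMul]
  have := he.jump_mul_le t (tensorRep_tmul (EventuallyEq.refl _ (fn a)) he.fn_eq)
    (ae_abs_le_supNorm a) (fun x hx y _ => by rw [mul_one]; exact hx)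
  linarith

lemma IsUnitVector.leftBounded (he : IsUnitVector e) : E.LeftBounded := fun a t => by
  rw [he.tensorForm_eq, he.tensorForm_eq, he.kernel_leftMul]
  have := he.jump_mul_le t (tensorRep_tmul he.fn_eq (EventuallyEq.refl _ (fn a)))
    (ae_abs_le_supNorm a) (fun x _ y hy => by rw [one_mul]; exact hy)
  linarith

end Positivity

/-! ### Layers of a function, and the absence of jumps for local forms. -/

section Locality

/-- The layers of height `h` of a non-negative number add up to it. -/
lemma sum_layers {h : ℝ} (hh : 0 ≤ h) (r : ℝ) (m : ℕ) :
    ∑ k ∈ Finset.range m, min h (max (r - k * h) 0) = min (m * h) (max r 0) := by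
  induction m with
  | zero => simp
  | succ m ih =>
    have hm : 0 ≤ (m : ℝ) * h := by positivity
    rw [Finset.sum_range_succ, ih]
    push_cast
    rcases le_total r (m * h) with h1 | h1
    · rw [max_eq_right (by linarith : r - m * h ≤ 0), min_eq_right hh, add_zero,
        min_eq_right (max_le h1 hm), min_eq_right (max_le (by linarith) (by linarith))]
    · rw [max_eq_left (by linarith : 0 ≤ r - m * h), max_eq_left (by linarith : 0 ≤ r),
        min_eq_left h1]
      rcases le_total r ((m + 1) * h) with h2 | h2
      · rw [min_eq_right (by linarith), min_eq_right h2]; ring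
      · rw [min_eq_left (by linarith), min_eq_left h2]; ring

/-- The indices below `N` at distance at least two from `k`. -/
def farIndices (N k : ℕ) : Finset ℕ := {l ∈ Finset.range N | k + 2 ≤ l ∨ l + 2 ≤ k}

/-- With `D` the whole sum, each `k` has at most three near indices, so the near products add up to
at most `3 h D ≤ (D² + 9 h²) / 2`, and `D² / 2` is absorbed on the left. -/
lemma sum_sq_le_far {h : ℝ} (N : ℕ) {d : ℕ → ℝ} (h0 : ∀ k, 0 ≤ d k) (h1 : ∀ k, d k ≤ h) :
    (∑ k ∈ Finset.range N, d k) ^ 2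
      ≤ 9 * h ^ 2 + 2 * ∑ k ∈ Finset.range N, ∑ l ∈ farIndices N k, d k * d l := by
  set D := ∑ k ∈ Finset.range N, d k with hD
  have hh : 0 ≤ h := (h0 0).trans (h1 0)
  have hnear : ∀ k, ∑ l ∈ Finset.range N with ¬ (k + 2 ≤ l ∨ l + 2 ≤ k), d k * d l
      ≤ d k * (3 * h) := by
    intro k
    rw [← Finset.mul_sum]
    refine mul_le_mul_of_nonneg_left ?_ (h0 k)
    have hsub : {l ∈ Finset.range N | ¬ (k + 2 ≤ l ∨ l + 2 ≤ k)} ⊆ Finset.Icc (k - 1) (k + 1) := by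
      intro l hl
      simp only [Finset.mem_filter, Finset.mem_Icc] at hl ⊢
      omega
    refine (Finset.sum_le_sum_of_subset_of_nonneg hsub fun l _ _ => h0 l).trans ?_
    refine (Finset.sum_le_card_nsmul _ _ h fun l _ => h1 l).trans ?_
    rw [nsmul_eq_mul]
    gcongr
    rw [Nat.card_Icc]
    exact_mod_cast (by omega : k + 1 + 1 - (k - 1) ≤ 3)
  have hsq : D ^ 2 = ∑ k ∈ Finset.range N, ∑ l ∈ farIndices N k, d k * d l
      + ∑ k ∈ Finset.range N,
        ∑ l ∈ Finset.range N with ¬ (k + 2 ≤ l ∨ l + 2 ≤ k), d k * d l := by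
    rw [sq, hD, Finset.sum_mul_sum, ← Finset.sum_add_distrib]
    refine Finset.sum_congr rfl fun k _ => ?_
    rw [farIndices, Finset.sum_filter_add_sum_filter_not]
  have hle := Finset.sum_le_sum fun k (_ : k ∈ Finset.range N) => hnear k
  rw [← Finset.sum_mul, ← hD] at hle
  nlinarith [sq_nonneg (D - 3 * h)]

/-- The increments of the layers of a bounded function control its increments. -/
lemma increment_pow_four_le {M h : ℝ} (hh : 0 ≤ h) {N : ℕ} (hN : N * h = 2 * M) {s t : ℝ}
    (hs : |s| ≤ M) (ht : |t| ≤ M) :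
    (s - t) ^ 4 ≤ 9 * h ^ 2 * (s - t) ^ 2 + 8 * M ^ 2 *
      ∑ k ∈ Finset.range N, ∑ l ∈ farIndices N k,
        (min h (max (s + M - k * h) 0) - min h (max (t + M - k * h) 0)) *
          (min h (max (s + M - l * h) 0) - min h (max (t + M - l * h) 0)) := by
  -- Both sides are symmetric in `s` and `t`; once they are ordered, all layer increments are
  -- non-negative.
  wlog hst : t ≤ s generalizing s t
  · have := this ht hs (le_of_not_ge hst)
    rw [show (s - t) ^ 4 = (t - s) ^ 4 by ring, show (s - t) ^ 2 = (t - s) ^ 2 by ring]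
    refine this.trans_eq (congrArg _ (congrArg _ (Finset.sum_congr rfl fun k _ =>
      Finset.sum_congr rfl fun l _ => ?_)))
    ring
  rw [abs_le] at hs ht
  set d : ℕ → ℝ := fun k => min h (max (s + M - k * h) 0) - min h (max (t + M - k * h) 0) with hd
  have h0 : ∀ k, 0 ≤ d k := fun k => sub_nonneg.2 (by gcongr)
  have h1 : ∀ k, d k ≤ h := fun k => by
    have h2 : min h (max (s + M - k * h) 0) ≤ h := min_le_left _ _
    have h3 : 0 ≤ min h (max (t + M - k * h) 0) := le_min hh (le_max_right _ _)
    simp only [hd]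
    linarith
  have hsum : ∑ k ∈ Finset.range N, d k = s - t := by
    simp only [hd, Finset.sum_sub_distrib, sum_layers hh, hN]
    rw [max_eq_left (by linarith), max_eq_left (by linarith), min_eq_right (by linarith),
      min_eq_right (by linarith)]
    ring
  have key := sum_sq_le_far N h0 h1
  rw [hsum] at key
  set Q := ∑ k ∈ Finset.range N, ∑ l ∈ farIndices N k, d k * d l with hQ
  have hQ0 : 0 ≤ Q := Finset.sum_nonneg fun k _ => Finset.sum_nonneg fun l _ =>
    mul_nonneg (h0 k) (h0 l)
  -- The factor `(s - t)²` is kept beside `9 h²`, so that this term vanishes for `s = t`, and is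
  -- bounded by `(2 M)²` beside the far sum, which vanishes there anyway.
  have hD : (s - t) ^ 2 ≤ 4 * M ^ 2 := by nlinarith
  calc (s - t) ^ 4 = (s - t) ^ 2 * (s - t) ^ 2 := by ring
    _ ≤ (s - t) ^ 2 * (9 * h ^ 2 + 2 * Q) := by gcongr
    _ = 9 * h ^ 2 * (s - t) ^ 2 + (s - t) ^ 2 * (2 * Q) := by ring
    _ ≤ 9 * h ^ 2 * (s - t) ^ 2 + 4 * M ^ 2 * (2 * Q) := by gcongr
    _ = _ := by ring

/-! ### Increments of functions as tensors. -/

section Increment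

variable {X : Type*} [MeasurableSpace X] {μ : Measure X} {E : DirichletForm μ} {e : E.bdd}

/-- The tensor `a ⊗ 𝟙 - 𝟙 ⊗ a`, representing the increments `a(x) - a(y)`. -/
noncomputable def increment (e a : E.bdd) : E.bdd ⊗[ℝ] E.bdd := a ⊗ₜ[ℝ] e - e ⊗ₜ[ℝ] a

lemma IsUnitVector.tensorRep_increment (he : IsUnitVector e) {a : E.bdd} {f : X → ℝ}
    (ha : fn a =ᵐ[μ] f) : TensorRep (increment e a) (fun x y => f x - f y) := by
  simpa [increment] using (tensorRep_tmul ha he.fn_eq).sub (tensorRep_tmul he.fn_eq ha)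

/-- Of the four terms of the product, `ab ⊗ 𝟙` and `𝟙 ⊗ ab` carry no energy; the two mixed terms
each give `𝓔(a, b)`. -/
lemma IsUnitVector.jump_increment_mul (he : IsUnitVector e) (a b : E.bdd) :
    E.jump (increment e a * increment e b) = 2 * E.energy a b := by
  simp only [increment, sub_mul, mul_sub, Algebra.TensorProduct.tmul_mul_tmul, map_sub,
    jump_tmul, he.mul_self_eq, he.energy_eq]
  rw [mul_comm e b, he.mul_self_eq, E.energy_symm e,
    he.energy_eq, E.energy_symm b a]
  ring

/-- The tensor representing the kernel `(a(x) - a(y))⁴`. -/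
noncomputable def incrementPowFour (e a : E.bdd) : E.bdd ⊗[ℝ] E.bdd :=
  (increment e a * increment e a) * (increment e a * increment e a)

lemma IsUnitVector.tensorRep_incrementPowFour (he : IsUnitVector e) {a : E.bdd} {f : X → ℝ}
    (ha : fn a =ᵐ[μ] f) : TensorRep (incrementPowFour e a) (fun x y => (f x - f y) ^ 4) := by
  have h := he.tensorRep_increment ha
  exact ((h.mul h).mul (h.mul h)).congr ⟨Set.univ, univ_mem, fun x _ y _ => by ring⟩

lemma IsUnitVector.exists_layer (he : IsUnitVector e) {a : E.bdd} {f : X → ℝ}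
    (ha : fn a =ᵐ[μ] f) {h : ℝ} (hh : 0 < h) (c : ℝ) :
    ∃ b : E.bdd, fn b =ᵐ[μ] fun x => min h (max (f x - c) 0) := by
  obtain ⟨w, hw, -⟩ := E.exists_trunc (E.incl a - c • E.incl e) hh
  have hu : E.Rep (E.incl a) f := ha
  have hv : E.Rep (E.incl e) (fun _ => 1) := he.fn_eq
  have hr := hu.sub (hv.smul c)
  unfold Rep at hr hw
  have hw' : ((w : Lp ℝ 2 μ) : X → ℝ) =ᵐ[μ] fun x => min h (max (f x - c) 0) := by
    filter_upwards [hr, hw] with x h1 h2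
    rw [h2, h1, mul_one]
  refine ⟨⟨w, w.2, ?_⟩, hw'⟩
  refine (memLp_top_of_bound (Lp.aestronglyMeasurable _) h ?_).2
  filter_upwards [hw'] with x hx
  rw [hx, Real.norm_of_nonneg (le_min hh.le (le_max_right _ _))]
  exact min_le_left _ _

lemma leftAct_eq_rightAct (hpos : E.TensorPos) (hL : E.LeftBounded) (hR : E.RightBounded)
    {a : E.bdd} (h : ∀ b c : E.bdd, leftAct hpos hL a (toHilb hpos (b ⊗ₜ[ℝ] c)) =
      rightAct hpos hR a (toHilb hpos (b ⊗ₜ[ℝ] c))) :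
    leftAct hpos hL a = rightAct hpos hR a := by
  refine DFunLike.coe_injective ((denseRange_toHilb hpos).equalizer
    (leftAct hpos hL a).continuous (rightAct hpos hR a).continuous (funext fun t => ?_))
  simp only [Function.comp_apply]
  induction t using TensorProduct.induction_on with
  | zero => simp
  | tmul b c => exact h b c
  | add s t hs ht => simp only [map_add, hs, ht]

end Increment

variable {X : Type*} [MetricSpace X] [MeasurableSpace X] {μ : Measure X}
  {E : DirichletForm μ} {e : E.bdd}

/-- Different non-adjacent layers of a continuous function are orthogonal. -/
lemma StronglyLocal.energy_layers_eq_zero (hloc : E.StronglyLocal) (g : C(X, ℝ)) {h c c' : ℝ}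
    (hc : c + h < c') {a b : E.bdd}
    (ha : fn a =ᵐ[μ] fun x => min h (max (g x - c) 0))
    (hb : fn b =ᵐ[μ] fun x => min h (max (g x - c') 0)) (hh : 0 ≤ h) : E.energy a b = 0 := by
  -- On this open set the lower layer is full, hence constantly `h`. The upper layer is supported in
  -- `{c' ≤ g}`, which lies inside it by the strict gap `c + h < c'`.
  refine hloc (E.incl a) (E.incl b) {x | c + h < g x} h
    (isOpen_lt continuous_const g.continuous) (Or.inl ⟨fun x hx => ?_, ?_⟩)
  · by_contra hlt
    rw [Set.mem_ofPred_eq, not_lt] at hlt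
    refine hx {y | g y < c'} ((isOpen_lt g.continuous continuous_const).mem_nhds
      (hlt.trans_lt hc)) ?_
    filter_upwards [hb] with y hy (hyU : g y < c')
    exact hy.trans (by rw [max_eq_right (by linarith), min_eq_right hh])
  · filter_upwards [ha] with y hy (hyU : c + h < g y)
    exact hy.trans (by rw [max_eq_left (by linarith), min_eq_left (by linarith)])

variable [CompactSpace X]

lemma Regular.isUnitVector_one (hreg : E.Regular) (hcons : E.Conservative) :
    IsUnitVector hreg.one where
  fn_eq := hreg.exists_one.choose_spec
  energy_eq a := hcons (E.incl a) (E.incl hreg.one) (Or.inr ⟨1, hreg.exists_one.choose_spec⟩)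
  form_eq v := hcons (E.incl hreg.one) v (Or.inl ⟨1, hreg.exists_one.choose_spec⟩)

/-- A continuous function of a strongly local form has no jumps. -/
lemma IsUnitVector.jump_incrementPowFour_nonpos_of_continuous (he : IsUnitVector e)
    (hloc : E.StronglyLocal) {a : E.bdd} {g : C(X, ℝ)} (ha : fn a =ᵐ[μ] g) :
    E.jump (incrementPowFour e a) ≤ 0 := by
  set M : ℝ := ‖g‖ + 1 with hM
  have hMpos : 0 < M := by positivity
  have hgM : ∀ x, |g x| ≤ M := fun x => (g.norm_coe_le_norm x).trans (by linarith)
  have key : ∀ n : ℕ, E.jump (incrementPowFour e a)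
      ≤ 9 * (2 * M * (1 / ((n : ℝ) + 1))) ^ 2 * (2 * E.energy a a) := by
    intro n
    set h : ℝ := 2 * M * (1 / ((n : ℝ) + 1)) with hh
    -- The `n + 1` layers of height `h` exactly fill `[-M, M]`; layer `k` starts at height `k h -
    -- M`.
    have hpos : 0 < h := by positivity
    have hNh : ((n + 1 : ℕ) : ℝ) * h = 2 * M := by
      rw [hh]; push_cast; field_simp
    choose b hb using fun k : ℕ => he.exists_layer ha hpos (k * h - M)
    have hb' : ∀ k, fn (b k) =ᵐ[μ] fun x => min h (max (g x + M - k * h) 0) := fun k => by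
      filter_upwards [hb k] with x hx
      rw [hx, show g x - (k * h - M) = g x + M - k * h by ring]
    -- Consecutive layers touch, so an index gap of two is needed for strict separation.
    have hfar : ∀ k l : ℕ, k + 2 ≤ l → E.energy (b k) (b l) = 0 := fun k l hkl => by
      refine hloc.energy_layers_eq_zero g ?_ (hb k) (hb l) hpos.le
      have : ((k + 2 : ℕ) : ℝ) * h ≤ l * h := by gcongr
      push_cast at this
      linarith
    set Q : E.bdd ⊗[ℝ] E.bdd := ∑ k ∈ Finset.range (n + 1), ∑ l ∈ farIndices (n + 1) k,
      increment e (b k) * increment e (b l) with hQ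
    have hjQ : E.jump Q = 0 := by
      simp only [hQ, map_sum, he.jump_increment_mul]
      refine Finset.sum_eq_zero fun k _ => Finset.sum_eq_zero fun l hl => ?_
      rcases (Finset.mem_filter.1 hl).2 with hl | hl
      · rw [hfar k l hl, mul_zero]
      · rw [E.energy_symm, hfar l k hl, mul_zero]
    have hδ := he.tensorRep_increment ha
    have hrepQ := TensorRep.sum (Finset.range (n + 1)) fun k _ =>
      TensorRep.sum (farIndices (n + 1) k) fun l _ =>
        (he.tensorRep_increment (hb' k)).mul (he.tensorRep_increment (hb' l))
    -- The far sum has `jump` zero, which leaves `9 h² · 2 𝓔(a, a)`, and this tends to zero as the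
    -- layers get thinner.
    have hle := he.jump_mono (he.tensorRep_incrementPowFour ha)
      (((hδ.mul hδ).smul (9 * h ^ 2)).add (hrepQ.smul (8 * M ^ 2))) univ_mem
      (fun x _ y _ => by
        have := increment_pow_four_le hpos.le hNh (hgM x) (hgM y)
        rw [← sq]
        exact this)
      (fun x _ => by simp)
    rw [map_add, map_smul, map_smul, he.jump_increment_mul, ← hQ, hjQ] at hle
    simpa using hle
  have hlim := (((tendsto_one_div_add_atTop_nhds_zero_nat (𝕜 := ℝ)).const_mul (2 * M)).pow 2
    |>.const_mul 9).mul_const (2 * E.energy a a)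
  simp only [mul_zero, ne_eq, OfNat.ofNat_ne_zero, not_false_eq_true, zero_pow, zero_mul] at hlim
  exact ge_of_tendsto' hlim key

/-- The bounded functions of a strongly local regular form have no jumps. -/
lemma IsUnitVector.jump_incrementPowFour_nonpos (he : IsUnitVector e)
    (hloc : E.StronglyLocal) (hreg : E.Regular) (a : E.bdd) :
    E.jump (incrementPowFour e a) ≤ 0 := by
  set M := supNorm a with hM
  have key : ∀ ε : ℝ, 0 < ε → E.jump (incrementPowFour e a) ≤ 16 * M ^ 2 * (2 * ε) := by
    intro ε hε
    obtain ⟨D, -, -, happ⟩ := hreg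
    obtain ⟨g, -, v, hv, hvε⟩ := happ (E.incl a) ε hε
    have hvb : eLpNorm ((v : Lp ℝ 2 μ) : X → ℝ) ∞ μ < ∞ := by
      refine (memLp_top_of_bound (Lp.aestronglyMeasurable _) ‖g‖ ?_).2
      unfold Rep at hv
      filter_upwards [hv] with x hx
      rw [hx]
      exact g.norm_coe_le_norm x
    set b : E.bdd := ⟨v, v.2, hvb⟩ with hb
    have hbg : fn b =ᵐ[μ] g := hv
    have hen : E.energy (a - b) (a - b) ≤ ε := by
      have e1 : E.incl (a - b) = E.incl a - v := by rw [map_sub]; rfl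
      have e2 : E.energy (a - b) (a - b) = E.form (E.incl (a - b)) (E.incl (a - b)) := rfl
      rw [e2, e1]
      linarith [sq_nonneg ‖E.incl a - v‖]
    have hsub : fn (a - b) =ᵐ[μ] fun x => fn a x - g x := by
      have h1 : E.Rep (E.incl a) (fn a) := ae_eq_refl _
      have h2 : E.Rep v g := hv
      exact h1.sub h2
    have hd := he.tensorRep_increment hsub
    -- For increments `D` of `a` and `G` of `g`, `D⁴ ≤ 16 M² (D - G)² + 4 G⁴`. The first term is
    -- paid by the energy of `a - b`, and the second has `jump` at most zero by the continuous case.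
    -- The constants involve only the bound of `a`: that of `g` is not controlled as `ε` shrinks.
    have hle := he.jump_mono (he.tensorRep_incrementPowFour (ae_eq_refl (fn a)))
      (((hd.mul hd).smul (16 * M ^ 2)).add ((he.tensorRep_incrementPowFour hbg).smul 4))
      (ae_abs_le_supNorm a)
      (fun x hx y hy => by
        have hx' : |fn a x| ≤ M := hx
        have hy' : |fn a y| ≤ M := hy
        rw [abs_le] at hx' hy'
        have e1 : fn a x - g x - (fn a y - g y) = (fn a x - fn a y) - (g x - g y) := by ring
        rw [e1]
        have hD : (fn a x - fn a y) ^ 2 ≤ 4 * M ^ 2 := by nlinarith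
        generalize fn a x - fn a y = D at hD
        generalize g x - g y = G
        have h1 : D ^ 2 ≤ 2 * (D - G) ^ 2 + 2 * G ^ 2 := by nlinarith [sq_nonneg (D - 2 * G)]
        have h2 : D ^ 2 * D ^ 2 ≤ D ^ 2 * (2 * (D - G) ^ 2 + 2 * G ^ 2) := by gcongr
        have h3 : D ^ 2 * (D - G) ^ 2 ≤ 4 * M ^ 2 * (D - G) ^ 2 := by gcongr
        nlinarith [sq_nonneg (D ^ 2 - 2 * G ^ 2)])
      (fun x _ => by ring)
    rw [map_add, map_smul, map_smul, he.jump_increment_mul, smul_eq_mul, smul_eq_mul] at hle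
    have hb0 := he.jump_incrementPowFour_nonpos_of_continuous hloc hbg
    have : 16 * M ^ 2 * (2 * E.energy (a - b) (a - b)) ≤ 16 * M ^ 2 * (2 * ε) := by gcongr
    linarith
  refine le_of_forall_pos_le_add fun ε hε => ?_
  -- This compensates the factor `32 M²`; the `+ 1` covers `M = 0`.
  have h := key (ε / (32 * (M ^ 2 + 1))) (by positivity)
  have h2 : 16 * M ^ 2 * (2 * (ε / (32 * (M ^ 2 + 1)))) = ε * (M ^ 2 / (M ^ 2 + 1)) := by
    field_simp
    ring
  have h3 : M ^ 2 / (M ^ 2 + 1) ≤ 1 := by rw [div_le_one (by positivity)]; linarith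
  nlinarith

/-- With `A` and `B` the increments of `a` and `b`, the commutator has kernel `-A B c(x)`, and `A²
B² c(x)² ≤ ‖c‖² (A⁴ + B⁴)`. By `jump_incrementPowFour_nonpos` the right side has `jump` at most
zero. -/
lemma IsUnitVector.tensorForm_commutator_eq_zero (he : IsUnitVector e)
    (hloc : E.StronglyLocal) (hreg : E.Regular) (a b c : E.bdd) :
    E.tensorForm (E.leftMul a (b ⊗ₜ[ℝ] c) - E.rightMul a (b ⊗ₜ[ℝ] c))
      (E.leftMul a (b ⊗ₜ[ℝ] c) - E.rightMul a (b ⊗ₜ[ℝ] c)) = 0 := by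
  refine le_antisymm ?_ (he.tensorPos _)
  rw [he.tensorForm_eq]
  have e1 : kernel e (E.leftMul a (b ⊗ₜ[ℝ] c) - E.rightMul a (b ⊗ₜ[ℝ] c))
      = kernel e (b ⊗ₜ[ℝ] c) * (e ⊗ₜ[ℝ] a) - kernel e (b ⊗ₜ[ℝ] c) * (a ⊗ₜ[ℝ] e) := by
    rw [map_sub, he.kernel_leftMul, he.kernel_rightMul]
  rw [e1]
  have hk := he.tensorRep_kernel_tmul b c
  have hs := (hk.mul (tensorRep_tmul he.fn_eq (ae_eq_refl (fn a)))).sub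
    (hk.mul (tensorRep_tmul (ae_eq_refl (fn a)) he.fn_eq))
  have hle := he.jump_mono (hs.mul hs) (((he.tensorRep_incrementPowFour (ae_eq_refl (fn a))).add
    (he.tensorRep_incrementPowFour (ae_eq_refl (fn b)))).smul (supNorm c ^ 2))
    (ae_abs_le_supNorm c)
    (fun x hx y _ => by
      have hc : fn c x ^ 2 ≤ supNorm c ^ 2 := by
        rw [← sq_abs]
        have : |fn c x| ≤ supNorm c := hx
        gcongr
      generalize hA : fn a x - fn a y = A
      generalize hB : fn b x - fn b y = B
      have h1 : A ^ 2 * B ^ 2 ≤ A ^ 4 + B ^ 4 := by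
        nlinarith [sq_nonneg (A ^ 2 - B ^ 2), sq_nonneg (A ^ 2), sq_nonneg (B ^ 2)]
      calc _ = fn c x ^ 2 * (A ^ 2 * B ^ 2) := by rw [← hA]; ring
        _ ≤ supNorm c ^ 2 * (A ^ 4 + B ^ 4) := by gcongr)
    (fun x _ => by ring)
  rw [map_smul, map_add, smul_eq_mul] at hle
  have ha := he.jump_incrementPowFour_nonpos hloc hreg a
  have hb := he.jump_incrementPowFour_nonpos hloc hreg b
  nlinarith [mul_nonneg (sq_nonneg (supNorm c)) (neg_nonneg.2 (add_nonpos ha hb))]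

lemma IsUnitVector.leftAct_toHilb_eq_rightAct (he : IsUnitVector e)
    (hloc : E.StronglyLocal) (hreg : E.Regular) (hpos : E.TensorPos) (hL : E.LeftBounded)
    (hR : E.RightBounded) (a b c : E.bdd) :
    leftAct hpos hL a (toHilb hpos (b ⊗ₜ[ℝ] c)) = rightAct hpos hR a (toHilb hpos (b ⊗ₜ[ℝ] c)) := by
  rw [leftAct_toHilb, rightAct_toHilb, ← sub_eq_zero, ← map_sub, ← inner_self_eq_zero (𝕜 := ℝ),
    inner_toHilb]
  exact he.tensorForm_commutator_eq_zero hloc hreg a b c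

/-- If the two actions agree, then `∂` is a derivation for the left action. -/
lemma deriv_mul (hreg : E.Regular) (hpos : E.TensorPos) (hL : E.LeftBounded)
    (hR : E.RightBounded) (he : IsUnitVector hreg.one)
    (h : ∀ a : E.bdd, leftAct hpos hL a = rightAct hpos hR a) (a b : E.bdd) :
    deriv hreg hpos (a * b) =
      leftAct hpos hL a (deriv hreg hpos b) + leftAct hpos hL b (deriv hreg hpos a) := by
  -- Once `b` acts from the right on `∂a`, the identity already holds in `𝓑 ⊗ 𝓑`: `(ab ⊗ 𝟙 - a ⊗ b)
  -- + a ⊗ b = ab ⊗ 𝟙`.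
  rw [h b]
  simp only [deriv]
  rw [leftAct_toHilb, rightAct_toHilb, ← map_add, leftMul_tmul, rightMul_tmul,
    mul_comm hreg.one b, he.mul_self_eq, sub_add_cancel]

end Locality

end DirichletForm

theorem mainTheorem11 {X : Type*} [MetricSpace X] [CompactSpace X] [MeasurableSpace X]
    [BorelSpace X] (μ : Measure X) [SigmaFinite μ] (E : DirichletForm μ)
    (hcons : E.Conservative) (hloc : E.StronglyLocal) (hreg : E.Regular) :
    ∃ (hpos : E.TensorPos) (hL : E.LeftBounded) (hR : E.RightBounded),
      (∀ a b c : E.bdd,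
        DirichletForm.leftAct hpos hL a (DirichletForm.toHilb hpos (b ⊗ₜ[ℝ] c)) =
          DirichletForm.rightAct hpos hR a (DirichletForm.toHilb hpos (b ⊗ₜ[ℝ] c))) ∧
      (∀ a : E.bdd, DirichletForm.leftAct hpos hL a = DirichletForm.rightAct hpos hR a) ∧
      ∀ a b : E.bdd,
        DirichletForm.deriv hreg hpos (a * b) =
          DirichletForm.leftAct hpos hL a (DirichletForm.deriv hreg hpos b) +
            DirichletForm.leftAct hpos hL b (DirichletForm.deriv hreg hpos a) := by
  have he := hreg.isUnitVector_one hcons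
  have hcomm := fun a b c => he.leftAct_toHilb_eq_rightAct hloc hreg he.tensorPos he.leftBounded
    he.rightBounded a b c
  have hact := fun a => DirichletForm.leftAct_eq_rightAct he.tensorPos he.leftBounded
    he.rightBounded (hcomm a)
  exact ⟨he.tensorPos, he.leftBounded, he.rightBounded, hcomm, hact,
    DirichletForm.deriv_mul hreg he.tensorPos he.leftBounded he.rightBounded he hact⟩
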